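/- Let $B$ be a standard Brownian motion and let $T\ge 0$ be a random time independent of $B$ with Lebesgue density $p_T$; write $\mathcal M[p_T](z)=\int_0^\infty p_T(t)t^{z-1}\,dt$ for its Mellin transform, and let $0\le a_T<1\le b_T$ be such that $\mathcal M[p_T](z)$ converges absolutely for $a_T<\operatorname{Re}z<b_T$. Let $X_1,X_2,\dots$ be i.i.d. with the law of $B_T$. Let $\max(a_T,3/4)<\gamma<b_T$ with also $a_T<2\gamma-1<b_T$, let $x>0$, and for bandwidths $h_n>0$ put $$p_{T,n}(x)=\frac1{\sqrt\pi}\int_{-1/h_n}^{1/h_n}\Bigl[\frac1n\sum_{k=1}^n|X_k|^{2(\gamma+iv-1)}\Bigr]\frac{x^{-\gamma-iv}}{2^{\gamma+iv}\,\Gamma(\gamma-1/2+iv)}\,dv .$$ Suppose that $$\frac{d}{du}\Bigl(\Gamma(2\gamma-3/2+iu)\,\mathcal M[p_T](2\gamma-1+iu)\Bigr)\Big|_{u=0}\ne 0\qquad\text{and}\qquad \int_{-\infty}^\infty\bigl|\mathcal M[p_T](2\gamma-1+iu)\bigr|\,du<\infty .$$ Then there is $\sigma^2>0$ (not depending on the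 choice of the sequences $h_n$ and $\rho_n$ below) such that for every sequence $h_n>0$ with $h_n\asymp 1/\log n$ and every sequence $$\rho_n=n^{-1/2}\Bigl(h_n^{2(\gamma-1)}\log^{-2}(1/h_n)\,e^{\pi/h_n}\Bigr)^{1/2}(1+o(1)),\qquad n\to\infty,$$ the estimator $p_{T,n}(x)$ is integrable for every $n$, and $$\rho_n^{-1}\bigl(p_{T,n}(x)-\mathbb E[p_{T,n}(x)]\bigr)\ \xrightarrow{\ \mathcal D\ }\ \mathcal N(0,\sigma^2),\qquad n\to\infty .$$ -/

import Mathlib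

open MeasureTheory ProbabilityTheory Filter Asymptotics
open scoped NNReal

namespace StatSkorohod

noncomputable section

/-- The empirical Mellin transform `(1/n) ∑ |X_k|^(z-1)` of the observations `X 0, …, X (n-1)`. -/
def empiricalMellin (X : ℕ → ℝ) (n : ℕ) (z : ℂ) : ℂ :=
  (n : ℂ)⁻¹ * ∑ k ∈ Finset.range n, ((|X k| : ℝ) : ℂ) ^ (z - 1)

/-- The kernel `K(y) = 1_{[-1,1]}(y)`. -/
def boxKernel (y : ℝ) : ℝ :=
  Set.indicator (Set.Icc (-1) 1) (fun _ => 1) y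

/-- The regularized Mellin inversion with bandwidth `h`, evaluated at `x`, as a complex number. -/
def estimatorC (X : ℕ → ℝ) (n : ℕ) (h γ x : ℝ) : ℂ :=
  ((1 / √Real.pi : ℝ) : ℂ) * ∫ v : ℝ,
    (x : ℂ) ^ (-(γ : ℂ) - Complex.I * v) * (boxKernel (v * h) : ℂ)
      * (empiricalMellin X n (2 * ((γ : ℂ) + Complex.I * v) - 1)
        / ((2 : ℂ) ^ ((γ : ℂ) + Complex.I * v)
            * Complex.Gamma ((γ : ℂ) - 1 / 2 + Complex.I * v)))

/-- The estimator `p_{T,n}(x)` of the density of `T`. It is a real number: taking the real part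
changes nothing, see `ofReal_estimator`. -/
def estimator (X : ℕ → ℝ) (n : ℕ) (h γ x : ℝ) : ℝ :=
  (estimatorC X n h γ x).re

theorem boxKernel_neg (y : ℝ) : boxKernel (-y) = boxKernel y := by
  unfold boxKernel Set.indicator
  have : (-y ∈ Set.Icc (-1 : ℝ) 1) ↔ (y ∈ Set.Icc (-1 : ℝ) 1) := by
    simp only [Set.mem_Icc]
    constructor <;> rintro ⟨h1, h2⟩ <;> constructor <;> linarith
  simp only [this]

theorem conj_cpow_of_nonneg {r : ℝ} (hr : 0 ≤ r) (s : ℂ) :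
    (starRingEnd ℂ) ((r : ℂ) ^ s) = (r : ℂ) ^ ((starRingEnd ℂ) s) := by
  have harg : (r : ℂ).arg ≠ Real.pi := by
    rw [Complex.arg_ofReal_of_nonneg hr]
    exact Real.pi_pos.ne
  rw [Complex.cpow_conj _ _ harg, Complex.conj_ofReal]

theorem conj_empiricalMellin (X : ℕ → ℝ) (n : ℕ) (z : ℂ) :
    (starRingEnd ℂ) (empiricalMellin X n z) = empiricalMellin X n ((starRingEnd ℂ) z) := by
  unfold empiricalMellin
  rw [map_mul, map_sum, map_inv₀, Complex.conj_natCast]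
  congr 1
  refine Finset.sum_congr rfl fun k _ => ?_
  rw [conj_cpow_of_nonneg (abs_nonneg _), map_sub, map_one]

/-- For `x ≥ 0` the estimator is real-valued. -/
theorem ofReal_estimator (X : ℕ → ℝ) (n : ℕ) (h γ : ℝ) {x : ℝ} (hx : 0 ≤ x) :
    ((estimator X n h γ x : ℝ) : ℂ) = estimatorC X n h γ x := by
  unfold estimator
  refine Complex.conj_eq_iff_re.1 ?_
  unfold estimatorC
  rw [map_mul, Complex.conj_ofReal, ← integral_conj]
  congr 1
  rw [← integral_neg_eq_self]
  congr 1
  funext v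
  have h2 : ∀ s : ℂ, (starRingEnd ℂ) ((2 : ℂ) ^ s) = (2 : ℂ) ^ ((starRingEnd ℂ) s) := by
    intro s
    have := conj_cpow_of_nonneg (r := 2) (by norm_num) s
    simpa using this
  simp only [map_mul, map_div₀, conj_cpow_of_nonneg hx, conj_empiricalMellin, h2,
    ← Complex.Gamma_conj, Complex.conj_ofReal, map_add, map_sub, map_neg, map_one,
    Complex.conj_I, Complex.conj_ofNat, neg_mul, boxKernel_neg, Complex.ofReal_neg, mul_neg,
    neg_neg]

end

end StatSkorohod

namespace StatSkorohod

open scoped Topology BoundedContinuousFunction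

section

/-! ### A central limit theorem for dominated triangular arrays -/

/-! Put `R = 1/h` and `c = γ - 1/2`. Merging the complex powers turns the estimator into an
empirical mean of `2 (2x)^(-γ) / √π * |y|^(2γ-2) * Re F_R(log (y²/(2x)))`, where `F_R(w)` is the
integral of `exp(ivw) / Γ(c+iv)` over `0 ≤ v ≤ R` (`estimator_eq_sum`). The problem is therefore a
central limit theorem for a triangular array whose summands depend on `n` only through `R`.

By Stirling's formula `1/Γ(c+iv)` has modulus of order `v^(1/2-c) e^(πv/2)`, so the end `v = R`
dominates `F_R`. The logarithmic derivative of the integrand is `π/2 + i(w - log v) + o(1)`: its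
real part stays away from zero whatever `w` is, so one integration by parts is uniform in the
frequency (`exists_norm_integral_inv_Gamma_sub_le`). The boundary term carries the factor `1 / log
R`, the source of the logarithm in the rate. After division by `R^(1/2-c) e^(πR/2) / log R`, which
is the square root in the rate (`sqrt_rate_eq`), `F_R(w)` differs by `o(1)` from an oscillation `A_R
exp(iRw)` with `|A_R| → 1/√(2π)`, and it is bounded by `C (1 + |w|)`.

The summands do not converge, but their first two moments do. With `w = log (y²/(2x))`, `exp(iRw)`
is `|y|^(2iR)` up to a unimodular constant, so oscillating expectations are moments of `B_T` far up
a vertical line. Such a moment is the Mellin transform of `p` times a bounded Gaussian moment, and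
it vanishes by Riemann-Lebesgue. Thus the mean tends to `0`, and in `(Re Z)² = |Z|²/2 + Re(Z²)/2`
only the first part survives. This gives the variance `σ² = (2x)^(-2γ) π^(-2) E|B_T|^(4γ-4)`, where
`γ > 3/4` and the position of `2γ-1` in the strip make the moment finite. Domination of all summands
by one square-integrable function then suffices for asymptotic normality
(`tendstoInDistribution_of_dominated`). -/

theorem norm_exp_mul_I_sub_taylor_le_sq (θ : ℝ) :
    ‖Complex.exp (θ * Complex.I) - (1 + θ * Complex.I - (θ : ℂ) ^ 2 / 2)‖ ≤ 4 * θ ^ 2 ∧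
    ‖Complex.exp (θ * Complex.I) - (1 + θ * Complex.I - (θ : ℂ) ^ 2 / 2)‖ ≤ 4 * |θ| ^ 3 := by
  have hn : ‖(θ : ℂ) * Complex.I‖ = |θ| := by simp
  rcases le_total |θ| 1 with h | h
  · have h3 := Complex.exp_bound (x := θ * Complex.I) (by rw [hn]; exact h) (n := 3) (by norm_num)
    rw [hn] at h3
    have e : ∑ m ∈ Finset.range 3, ((θ : ℂ) * Complex.I) ^ m / (m.factorial : ℂ)
        = 1 + θ * Complex.I - (θ : ℂ) ^ 2 / 2 := by
      simp [Finset.sum_range_succ, Nat.factorial, mul_pow]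
      ring
    rw [e] at h3
    norm_num [Nat.factorial] at h3
    have h0 : 0 ≤ |θ| := abs_nonneg _
    have h2 : |θ| ^ 3 ≤ θ ^ 2 := by
      rw [← sq_abs]; nlinarith [sq_nonneg |θ|]
    have h4 : 0 ≤ |θ| ^ 3 := by positivity
    constructor <;> linarith
  · have h1 : ‖Complex.exp (θ * Complex.I) - (1 + θ * Complex.I - (θ : ℂ) ^ 2 / 2)‖
        ≤ 1 + (1 + |θ| + |θ| ^ 2 / 2) := by
      refine (norm_sub_le _ _).trans (add_le_add (Complex.norm_exp_ofReal_mul_I θ).le ?_)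
      refine (norm_sub_le _ _).trans (add_le_add ((norm_add_le _ _).trans ?_) ?_)
      · rw [hn]; simp
      · simp
    have h2 : |θ| ≤ |θ| ^ 2 := by nlinarith
    have h3 : |θ| ^ 2 ≤ |θ| ^ 3 := by nlinarith [sq_nonneg |θ|]
    rw [← sq_abs θ]
    constructor <;> nlinarith

variable {Ω : Type*} {mΩ : MeasurableSpace Ω} {P : Measure Ω} [IsProbabilityMeasure P]

/-- Lindeberg's argument with domination in place of the Lindeberg condition. Of the two bounds on
the Taylor remainder of `exp(iθ)`, the quadratic one makes `n` times the remainder dominated by a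
multiple of `D²`, and the cubic one makes it tend to zero pointwise. The variables `W n` themselves
need not converge; only their variances must. -/
theorem tendsto_charFun_pow_of_dominated {W : ℕ → Ω → ℝ} {D : Ω → ℝ} {v : ℝ}
    (hW : ∀ n, AEMeasurable (W n) P) (hD : Integrable (fun ω => D ω ^ 2) P)
    (hWD : ∀ᶠ n in atTop, ∀ᵐ ω ∂P, |W n ω| ≤ D ω)
    (h0 : ∀ n, ∫ ω, W n ω ∂P = 0)
    (h2 : Tendsto (fun n => ∫ ω, W n ω ^ 2 ∂P) atTop (𝓝 v)) (t : ℝ) :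
    Tendsto (fun n : ℕ => charFun (P.map (W n)) ((√(n : ℝ))⁻¹ * t) ^ n) atTop
      (𝓝 (Complex.exp (-((v : ℂ) * t ^ 2 / 2)))) := by
  set r : ℕ → Ω → ℂ := fun n ω =>
    (n : ℂ) * (Complex.exp ((((√(n : ℝ))⁻¹ * t * W n ω : ℝ) : ℂ) * Complex.I)
      - (1 + (((√(n : ℝ))⁻¹ * t * W n ω : ℝ) : ℂ) * Complex.I
        - ((((√(n : ℝ))⁻¹ * t * W n ω : ℝ) : ℂ)) ^ 2 / 2)) with hr
  have hrm : ∀ n, AEStronglyMeasurable (r n) P := by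
    intro n
    have := hW n
    refine AEMeasurable.aestronglyMeasurable ?_
    fun_prop
  have hsq : ∀ n : ℕ, 0 < n → √(n : ℝ) ^ 2 = n := fun n _ => Real.sq_sqrt (Nat.cast_nonneg n)
  have hr2 : ∀ᶠ n in atTop, ∀ᵐ ω ∂P, ‖r n ω‖ ≤ 4 * t ^ 2 * D ω ^ 2 := by
    filter_upwards [hWD, eventually_gt_atTop 0] with n hn hpos
    filter_upwards [hn] with ω hω
    have hb := (norm_exp_mul_I_sub_taylor_le_sq ((√(n : ℝ))⁻¹ * t * W n ω)).1
    have hs : 0 < √(n : ℝ) := Real.sqrt_pos.2 (by exact_mod_cast hpos)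
    rw [hr, norm_mul, Complex.norm_natCast]
    calc (n : ℝ) * _ ≤ n * (4 * ((√(n : ℝ))⁻¹ * t * W n ω) ^ 2) := by gcongr
      _ = 4 * t ^ 2 * |W n ω| ^ 2 := by
        rw [sq_abs]; nth_rewrite 1 [← hsq n hpos]; field_simp
      _ ≤ _ := by gcongr
  have hr3 : ∀ᵐ ω ∂P, Tendsto (fun n => r n ω) atTop (𝓝 0) := by
    have hWD' : ∀ᵐ ω ∂P, ∀ᶠ n in atTop, |W n ω| ≤ D ω := by
      obtain ⟨N, hN⟩ := eventually_atTop.1 hWD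
      have : ∀ᵐ ω ∂P, ∀ n, N ≤ n → |W n ω| ≤ D ω :=
        ae_all_iff.2 fun n => by
          by_cases h : N ≤ n
          · filter_upwards [hN n h] with ω hω _ using hω
          · exact Eventually.of_forall fun ω h' => absurd h' h
      filter_upwards [this] with ω hω
      exact eventually_atTop.2 ⟨N, hω⟩
    filter_upwards [hWD'] with ω hω
    have hlim : Tendsto (fun n : ℕ => 4 * |t| ^ 3 * D ω ^ 3 * (√(n : ℝ))⁻¹) atTop (𝓝 0) := by
      rw [← mul_zero (4 * |t| ^ 3 * D ω ^ 3)]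
      exact (tendsto_inv_atTop_zero.comp <| Real.tendsto_sqrt_atTop.comp
        tendsto_natCast_atTop_atTop).const_mul _
    refine squeeze_zero_norm' ?_ hlim
    filter_upwards [hω, eventually_gt_atTop 0] with n hn hpos
    have hb := (norm_exp_mul_I_sub_taylor_le_sq ((√(n : ℝ))⁻¹ * t * W n ω)).2
    have hs : 0 < √(n : ℝ) := Real.sqrt_pos.2 (by exact_mod_cast hpos)
    rw [hr, norm_mul, Complex.norm_natCast]
    calc (n : ℝ) * _ ≤ n * (4 * |(√(n : ℝ))⁻¹ * t * W n ω| ^ 3) := by gcongr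
      _ = 4 * |t| ^ 3 * |W n ω| ^ 3 * (√(n : ℝ))⁻¹ := by
        rw [abs_mul, abs_mul, abs_of_pos (inv_pos.2 hs)]
        nth_rewrite 1 [← hsq n hpos]; field_simp
      _ ≤ _ := by gcongr
  have hrlim : Tendsto (fun n => ∫ ω, r n ω ∂P) atTop (𝓝 0) := by
    rw [← integral_zero Ω ℂ (μ := P)]
    exact tendsto_integral_filter_of_dominated_convergence (fun ω => 4 * t ^ 2 * D ω ^ 2)
      (Eventually.of_forall hrm) hr2 (hD.const_mul _) hr3
  have key : ∀ᶠ n : ℕ in atTop, (∫ ω, r n ω ∂P) + (-((∫ ω, W n ω ^ 2 ∂P : ℝ) * (t : ℂ) ^ 2 / 2))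
      = n * (charFun (P.map (W n)) ((√(n : ℝ))⁻¹ * t) - 1) := by
    filter_upwards [hWD, eventually_gt_atTop 0] with n hn hpos
    have hs : 0 < √(n : ℝ) := Real.sqrt_pos.2 (by exact_mod_cast hpos)
    have hW2 : Integrable (fun ω => W n ω ^ 2) P := by
      refine hD.mono' ((hW n).pow_const 2).aestronglyMeasurable ?_
      filter_upwards [hn] with ω hω
      rw [Real.norm_eq_abs, abs_pow]
      exact pow_le_pow_left₀ (abs_nonneg _) hω 2
    have hW1 : Integrable (W n) P :=
      ((memLp_two_iff_integrable_sq (hW n).aestronglyMeasurable).2 hW2).integrable (by norm_num)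
    have hE : Integrable (fun ω => Complex.exp ((((√(n : ℝ))⁻¹ * t * W n ω : ℝ) : ℂ) * Complex.I))
        P := by
      refine Integrable.of_bound (AEMeasurable.aestronglyMeasurable ?_) 1
        (Eventually.of_forall fun ω => (Complex.norm_exp_ofReal_mul_I _).le)
      have := hW n
      fun_prop
    have hI1 : Integrable (fun ω => (((√(n : ℝ))⁻¹ * t * W n ω : ℝ) : ℂ) * Complex.I) P :=
      ((hW1.const_mul _).ofReal).mul_const _
    have hI2 : Integrable (fun ω => (((√(n : ℝ))⁻¹ * t * W n ω : ℝ) : ℂ) ^ 2 / 2) P := by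
      have := ((hW2.const_mul (((√(n : ℝ))⁻¹ * t) ^ 2)).ofReal (𝕜 := ℂ)).div_const 2
      refine this.congr (Eventually.of_forall fun ω => ?_)
      beta_reduce
      rw [← mul_pow, ← Complex.ofReal_pow]
      rfl
    have e1 : ∫ ω, (((√(n : ℝ))⁻¹ * t * W n ω : ℝ) : ℂ) * Complex.I ∂P = 0 := by
      rw [integral_mul_const, integral_complex_ofReal, integral_const_mul, h0 n]; simp
    have e2 : ∫ ω, (((√(n : ℝ))⁻¹ * t * W n ω : ℝ) : ℂ) ^ 2 / 2 ∂P
        = (n : ℂ)⁻¹ * ((∫ ω, W n ω ^ 2 ∂P : ℝ) * (t : ℂ) ^ 2 / 2) := by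
      rw [integral_div]
      have : (fun ω => (((√(n : ℝ))⁻¹ * t * W n ω : ℝ) : ℂ) ^ 2)
          = fun ω => (((n : ℝ)⁻¹ * t ^ 2 * W n ω ^ 2 : ℝ) : ℂ) := by
        funext ω
        rw [← Complex.ofReal_pow, mul_pow, mul_pow, inv_pow, hsq n hpos]
      rw [this, integral_complex_ofReal, integral_const_mul]
      push_cast; ring
    have e3 : charFun (P.map (W n)) ((√(n : ℝ))⁻¹ * t)
        = ∫ ω, Complex.exp ((((√(n : ℝ))⁻¹ * t * W n ω : ℝ) : ℂ) * Complex.I) ∂P := by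
      rw [charFun_apply_real, integral_map (hW n)
        (Continuous.aestronglyMeasurable (by fun_prop))]
      simp
    have hI3 : Integrable (fun ω => 1 + (((√(n : ℝ))⁻¹ * t * W n ω : ℝ) : ℂ) * Complex.I) P :=
      (integrable_const 1).add hI1
    have hI4 : Integrable (fun ω => 1 + (((√(n : ℝ))⁻¹ * t * W n ω : ℝ) : ℂ) * Complex.I
        - (((√(n : ℝ))⁻¹ * t * W n ω : ℝ) : ℂ) ^ 2 / 2) P := hI3.sub hI2
    rw [hr, integral_const_mul, integral_sub hE hI4, integral_sub hI3 hI2,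
      integral_add (integrable_const 1) hI1, e1, e2, e3]
    have hn0 : (n : ℂ) ≠ 0 := by exact_mod_cast hpos.ne'
    generalize ∫ ω, Complex.exp ((((√(n : ℝ))⁻¹ * t * W n ω : ℝ) : ℂ) * Complex.I) ∂P = J
    simp
    field_simp
    ring
  have hfin := Complex.tendsto_one_add_pow_exp_of_tendsto
    (g := fun n => charFun (P.map (W n)) ((√(n : ℝ))⁻¹ * t) - 1)
    (t := -((v : ℂ) * t ^ 2 / 2)) (by
      refine Tendsto.congr' key ?_
      have h2' : Tendsto (fun n => ((∫ ω, W n ω ^ 2 ∂P : ℝ) : ℂ)) atTop (𝓝 (v : ℂ)) :=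
        (Complex.continuous_ofReal.tendsto v).comp h2
      simpa using hrlim.add ((h2'.mul_const ((t : ℂ) ^ 2)).div_const 2).neg)
  simpa using hfin

/-- Normalized sums of `f n (X k)`, where `X` is an i.i.d. sample and the functions `f n`, centered,
are dominated by one square-integrable function, are asymptotically normal. -/
theorem tendstoInDistribution_of_dominated {X : ℕ → Ω → ℝ} (hX : ∀ k, Measurable (X k))
    (hindep : iIndepFun X P) (hident : ∀ k, IdentDistrib (X k) (X 0) P P)
    {f : ℕ → ℝ → ℝ} (hf : ∀ n, Measurable (f n)) {D : ℝ → ℝ}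
    (hD : Integrable (fun ω => D (X 0 ω) ^ 2) P)
    (hfD : ∀ᶠ n in atTop, ∀ᵐ ω ∂P, |f n (X 0 ω)| ≤ D (X 0 ω))
    (h0 : ∀ n, ∫ ω, f n (X 0 ω) ∂P = 0) {v : ℝ≥0}
    (h2 : Tendsto (fun n => ∫ ω, f n (X 0 ω) ^ 2 ∂P) atTop (𝓝 (v : ℝ))) :
    TendstoInDistribution (fun (n : ℕ) ω => (√(n : ℝ))⁻¹ * ∑ k ∈ Finset.range n, f n (X k ω))
      atTop (id : ℝ → ℝ) (fun _ => P) (gaussianReal 0 v) where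
  forall_aemeasurable n := by
    have := hf n
    fun_prop
  tendsto := by
    refine ProbabilityMeasure.tendsto_iff_tendsto_charFun.2 fun t => ?_
    have e : ∀ n : ℕ, charFun (P.map (fun ω => (√(n : ℝ))⁻¹ * ∑ k ∈ Finset.range n, f n (X k ω))) t
        = charFun (P.map (fun ω => f n (X 0 ω))) ((√(n : ℝ))⁻¹ * t) ^ n := fun n =>
      charFun_inv_sqrt_mul_sum (X := fun k ω => f n (X k ω))
        (hindep.comp (fun _ => f n) (fun _ => hf n)) (fun k => (hident k).comp (hf n))
    have := tendsto_charFun_pow_of_dominated (W := fun n ω => f n (X 0 ω))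
      (D := fun ω => D (X 0 ω)) (fun n => ((hf n).comp (hX 0)).aemeasurable) hD hfD h0 h2 t
    simp only [ProbabilityMeasure.coe_mk, e, Measure.map_id, charFun_gaussianReal]
    simpa using this

end

/-! ### Brownian motion at an independent random time -/

theorem tendsto_ceil_mul_natCast_div (t : ℝ≥0) :
    Tendsto (fun m : ℕ => ((⌈(t : ℝ) * m⌉₊ : ℝ≥0) / (m : ℝ≥0))) atTop (𝓝 t) := by
  rw [← NNReal.tendsto_coe]
  have := (tendsto_nat_ceil_mul_div_atTop (R := ℝ) t.2).comp tendsto_natCast_atTop_atTop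
  simpa [Function.comp_def] using this

/-- Evaluating a path at a real time is not measurable for the product σ-algebra, so Fubini cannot
be applied to `T` directly. It is applied to the discretized times `⌈T m⌉ / m`, which take countably
many values; path continuity and dominated convergence then give the limit in `m`. -/
theorem map_brownian_independent_time {Ω : Type*} {mΩ : MeasurableSpace Ω} {P : Measure Ω}
    [IsProbabilityMeasure P] {B : ℝ≥0 → Ω → ℝ} (hBmeas : ∀ t, Measurable (B t))
    (hB : IsBrownianReal B P) {T : Ω → ℝ≥0} (hT : Measurable T)
    (hTB : IndepFun T (fun ω t => B t ω) P) (hBT : AEMeasurable (fun ω => B (T ω) ω) P) :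
    P.map (fun ω => B (T ω) ω) =
      ((P.map fun ω => (T ω : ℝ)).prod (gaussianReal 0 1)).map (fun q => √q.1 * q.2) := by
  have hTr : Measurable fun ω => (T ω : ℝ) := by fun_prop
  have := Measure.isProbabilityMeasure_map (μ := P) hTr.aemeasurable
  have := Measure.isProbabilityMeasure_map hBT
  have hpath : Measurable fun ω t => B t ω := measurable_pi_lambda _ hBmeas
  have hq : Measurable fun q : ℝ × ℝ => √q.1 * q.2 := by fun_prop
  have := Measure.isProbabilityMeasure_map (μ := (P.map fun ω => (T ω : ℝ)).prod (gaussianReal 0 1))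
    hq.aemeasurable
  refine ext_of_forall_integral_eq_of_IsFiniteMeasure fun f => ?_
  have hfm : Measurable f := f.continuous.measurable
  set G : ℝ → ℝ := fun s => ∫ y, f (√s * y) ∂(gaussianReal 0 1) with hG
  have hGb : ∀ s, ‖G s‖ ≤ ‖f‖ := fun s => by
    simpa using norm_integral_le_of_norm_le_const (μ := gaussianReal 0 1)
      (Eventually.of_forall fun y => f.norm_coe_le_norm (√s * y))
  have hGc : Continuous G := by
    refine continuous_of_dominated (F := fun (s y : ℝ) => f (√s * y)) (bound := fun _ => ‖f‖)
      (fun s => ?_) (fun s => Eventually.of_forall fun y => f.norm_coe_le_norm _)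
      (integrable_const _) (Eventually.of_forall fun y => by fun_prop)
    exact Continuous.aestronglyMeasurable (by fun_prop)
  have hgauss : ∀ s : ℝ≥0, ∫ ω, f (B s ω) ∂P = G s := by
    intro s
    have h1 : P.map (B s) = (gaussianReal 0 1).map (fun y => √(s : ℝ) * y) := by
      rw [(hB.hasLaw_eval s).map_eq, gaussianReal_map_const_mul]
      congr 1
      · simp
      · ext; simp
    rw [← integral_map (hBmeas s).aemeasurable f.continuous.aestronglyMeasurable, h1,
      integral_map (by fun_prop) f.continuous.aestronglyMeasurable]
  have hstep : ∀ m : ℕ, ∫ ω, f (B ((⌈(T ω : ℝ) * m⌉₊ : ℝ≥0) / (m : ℝ≥0)) ω) ∂P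
      = ∫ ω, G ((⌈(T ω : ℝ) * m⌉₊ : ℝ) / (m : ℝ)) ∂P := by
    intro m
    set N : Ω → ℕ := fun ω => ⌈(T ω : ℝ) * m⌉₊ with hN
    have hNm : Measurable N := Nat.measurable_ceil.comp (hTr.mul_const _)
    have hind : IndepFun N (fun ω t => B t ω) P :=
      hTB.comp (φ := fun t : ℝ≥0 => ⌈(t : ℝ) * m⌉₊) (ψ := id)
        (Nat.measurable_ceil.comp (by fun_prop)) measurable_id
    have hmap := (indepFun_iff_map_prod_eq_prod_map_map hNm.aemeasurable hpath.aemeasurable).1 hind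
    set F : ℕ × (ℝ≥0 → ℝ) → ℝ := fun q => f (q.2 ((q.1 : ℝ≥0) / (m : ℝ≥0))) with hF
    -- This is where discreteness of the time is needed: for each fixed `k` the map is a coordinate
    -- evaluation followed by `f`.
    have hFm : Measurable F := measurable_from_prod_countable_right fun k =>
      hfm.comp (measurable_pi_apply ((k : ℝ≥0) / (m : ℝ≥0)))
    have := Measure.isProbabilityMeasure_map (μ := P) hNm.aemeasurable
    have := Measure.isProbabilityMeasure_map (μ := P) hpath.aemeasurable
    calc ∫ ω, f (B ((⌈(T ω : ℝ) * m⌉₊ : ℝ≥0) / (m : ℝ≥0)) ω) ∂P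
        = ∫ q, F q ∂(P.map fun ω => (N ω, fun t => B t ω)) := by
          rw [integral_map (hNm.prodMk hpath).aemeasurable hFm.aestronglyMeasurable]
      _ = ∫ k, ∫ b, F (k, b) ∂(P.map fun ω t => B t ω) ∂(P.map N) := by
          rw [hmap, integral_prod]
          exact Integrable.of_bound hFm.aestronglyMeasurable ‖f‖
            (Eventually.of_forall fun q => f.norm_coe_le_norm _)
      _ = ∫ k, G ((k : ℝ) / m) ∂(P.map N) := by
          refine integral_congr_ae (Eventually.of_forall fun k => ?_)
          beta_reduce
          have hk : Measurable fun b : ℝ≥0 → ℝ => F (k, b) := hFm.comp measurable_prodMk_left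
          rw [integral_map hpath.aemeasurable hk.aestronglyMeasurable]
          simpa using hgauss ((k : ℝ≥0) / m)
      _ = _ := by
          rw [integral_map hNm.aemeasurable (measurable_from_top).aestronglyMeasurable]
  have hlim1 : Tendsto (fun m : ℕ => ∫ ω, f (B ((⌈(T ω : ℝ) * m⌉₊ : ℝ≥0) / (m : ℝ≥0)) ω) ∂P) atTop
      (𝓝 (∫ ω, f (B (T ω) ω) ∂P)) := by
    refine tendsto_integral_of_dominated_convergence (fun _ => ‖f‖) (fun m => ?_)
      (integrable_const _) (fun m => Eventually.of_forall fun ω => f.norm_coe_le_norm _) ?_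
    · have hNm : Measurable fun ω => ⌈(T ω : ℝ) * m⌉₊ := Nat.measurable_ceil.comp (hTr.mul_const _)
      have hm : Measurable fun q : ℕ × Ω => B ((q.1 : ℝ≥0) / (m : ℝ≥0)) q.2 :=
        measurable_from_prod_countable_right fun k => hBmeas ((k : ℝ≥0) / (m : ℝ≥0))
      exact (hfm.comp (hm.comp (hNm.prodMk measurable_id))).aestronglyMeasurable
    · filter_upwards [hB.cont] with ω hω
      exact ((f.continuous.comp hω).tendsto (T ω)).comp (tendsto_ceil_mul_natCast_div (T ω))
  have hlim2 : Tendsto (fun m : ℕ => ∫ ω, G ((⌈(T ω : ℝ) * m⌉₊ : ℝ) / (m : ℝ)) ∂P) atTop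
      (𝓝 (∫ ω, G (T ω) ∂P)) := by
    refine tendsto_integral_of_dominated_convergence (fun _ => ‖f‖) (fun m => ?_)
      (integrable_const _) (fun m => Eventually.of_forall fun ω => hGb _)
      (Eventually.of_forall fun ω => ?_)
    · have hNm : Measurable fun ω => ⌈(T ω : ℝ) * m⌉₊ := Nat.measurable_ceil.comp (hTr.mul_const _)
      exact (hGc.measurable.comp (by fun_prop)).aestronglyMeasurable
    · refine (hGc.tendsto _).comp ?_
      have := (NNReal.tendsto_coe.2 (tendsto_ceil_mul_natCast_div (T ω)))
      simpa using this
  have heq := tendsto_nhds_unique hlim1 ((tendsto_congr hstep).2 hlim2)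
  rw [integral_map hBT hfm.aestronglyMeasurable, heq,
    integral_map hq.aemeasurable hfm.aestronglyMeasurable, integral_prod,
    integral_map hTr.aemeasurable hGc.aestronglyMeasurable]
  exact Integrable.of_bound (hfm.comp hq).aestronglyMeasurable ‖f‖
    (Eventually.of_forall fun q => f.norm_coe_le_norm _)

section

/-! ### Absolute moments of Brownian motion at an independent random time -/

theorem integrable_comp_abs {f : ℝ → ℝ} (hf : IntegrableOn f (Set.Ioi 0)) :
    Integrable fun y => f |y| := by
  have h1 : IntegrableOn (fun y => f |y|) (Set.Ioi 0) :=
    hf.congr_fun (fun y hy => by rw [abs_of_pos hy]) measurableSet_Ioi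
  have h2 : IntegrableOn (fun y => f |y|) (Set.Iic 0) := by
    have : IntegrableOn (fun y => f |y|) (Set.Ici (-0)) := by
      rw [neg_zero]
      exact (integrableOn_Ici_iff_integrableOn_Ioi enorm_ne_top).2 h1
    simpa using this.comp_neg_Iic
  have := h2.union h1
  rwa [Set.Iic_union_Ioi, integrableOn_univ] at this

theorem integrable_abs_rpow_gaussianReal {s : ℝ} (hs : -1 < s) :
    Integrable (fun y : ℝ => |y| ^ s) (gaussianReal 0 1) := by
  rw [gaussianReal_of_var_ne_zero _ one_ne_zero, integrable_withDensity_iff_integrable_smul'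
    (measurable_gaussianPDF _ _) (ae_of_all _ fun _ => gaussianPDF_lt_top)]
  have := (integrable_comp_abs (integrableOn_rpow_mul_exp_neg_mul_sq (b := 1 / 2) (by norm_num)
    hs)).const_mul (√(2 * Real.pi * 1))⁻¹
  refine this.congr (Eventually.of_forall fun y => ?_)
  simp [toReal_gaussianPDF, gaussianPDFReal]
  ring_nf

theorem ae_ne_zero_gaussianReal : ∀ᵐ y ∂(gaussianReal 0 1), y ≠ 0 :=
  (gaussianReal_absolutelyContinuous 0 one_ne_zero).ae_le (compl_mem_ae_iff.2 (measure_singleton 0))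

/-- Riemann-Lebesgue in the variable `log t`. No convergence is required, because a divergent
Bochner integral is zero by convention. -/
theorem tendsto_mellin_vertical (f : ℝ → ℂ) (σ : ℝ) :
    Tendsto (fun u : ℝ => mellin f (σ + u * Complex.I)) atTop (𝓝 0) := by
  simp only [mellin_eq_fourier]
  have h : Tendsto (fun u : ℝ => u / (2 * Real.pi)) atTop (cocompact ℝ) :=
    (tendsto_id.atTop_div_const (by positivity)).mono_right atTop_le_cocompact
  simpa [Function.comp_def] using (Real.zero_at_infty_fourier
    (fun u : ℝ => Real.exp (-σ * u) • f (Real.exp (-u)))).comp h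

variable {p : ℝ → ℝ}

/-- The Mellin transform sees only `p` on the positive half-line; this passes from the full law of
`T` to that half-line. -/
theorem withDensity_eq_restrict_of_Iic_zero
    (h0 : volume.withDensity (fun t => ENNReal.ofReal (p t)) (Set.Iic 0) = 0) :
    volume.withDensity (fun t => ENNReal.ofReal (p t)) =
      (volume.restrict (Set.Ioi 0)).withDensity (fun t => ENNReal.ofReal (p t)) := by
  rw [← restrict_withDensity measurableSet_Ioi]
  refine (Measure.restrict_eq_self_of_ae_mem ?_).symm
  have : (Set.Iic (0 : ℝ))ᶜ ∈ ae (volume.withDensity (fun t => ENNReal.ofReal (p t))) :=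
    compl_mem_ae_iff.2 h0
  filter_upwards [this] with t ht
  simpa using ht

theorem integrable_cpow_withDensity (hpmeas : Measurable p) (hp : ∀ t, 0 ≤ p t)
    (h0 : volume.withDensity (fun t => ENNReal.ofReal (p t)) (Set.Iic 0) = 0) {z : ℂ}
    (hz : MellinConvergent (fun t => (p t : ℂ)) (z + 1)) :
    Integrable (fun t : ℝ => (t : ℂ) ^ z)
      (volume.withDensity fun t => ENNReal.ofReal (p t)) := by
  rw [withDensity_eq_restrict_of_Iic_zero h0, integrable_withDensity_iff_integrable_smul'
    hpmeas.ennreal_ofReal (ae_of_all _ fun _ => ENNReal.ofReal_lt_top)]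
  refine Integrable.congr hz (Eventually.of_forall fun t => ?_)
  simp [ENNReal.toReal_ofReal (hp t), mul_comm]

theorem integral_cpow_withDensity (hpmeas : Measurable p) (hp : ∀ t, 0 ≤ p t)
    (h0 : volume.withDensity (fun t => ENNReal.ofReal (p t)) (Set.Iic 0) = 0) (z : ℂ) :
    ∫ t : ℝ, (t : ℂ) ^ z ∂(volume.withDensity fun t => ENNReal.ofReal (p t))
      = mellin (fun t => (p t : ℂ)) (z + 1) := by
  rw [withDensity_eq_restrict_of_Iic_zero h0, integral_withDensity_eq_integral_toReal_smul
    hpmeas.ennreal_ofReal (ae_of_all _ fun _ => ENNReal.ofReal_lt_top), mellin]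
  refine integral_congr_ae (Eventually.of_forall fun t => ?_)
  simp [ENNReal.toReal_ofReal (hp t), mul_comm]

theorem norm_ofReal_cpow_of_ne_zero {y : ℝ} (hy : y ≠ 0) (z : ℂ) :
    ‖((|y| : ℝ) : ℂ) ^ z‖ = |y| ^ z.re :=
  Complex.norm_cpow_eq_rpow_re_of_pos (abs_pos.2 hy) z

theorem measurable_abs_cpow (z : ℂ) : Measurable fun y : ℝ => ((|y| : ℝ) : ℂ) ^ z := by
  fun_prop

theorem integrable_abs_cpow_gaussianReal {z : ℂ} (hz : -1 < z.re) :
    Integrable (fun y : ℝ => ((|y| : ℝ) : ℂ) ^ z) (gaussianReal 0 1) := by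
  refine (integrable_abs_rpow_gaussianReal hz).mono' (measurable_abs_cpow z).aestronglyMeasurable ?_
  filter_upwards [ae_ne_zero_gaussianReal] with y hy
  rw [norm_ofReal_cpow_of_ne_zero hy]

theorem ofReal_sqrt_cpow {t : ℝ} (ht : 0 < t) (z : ℂ) : ((√t : ℝ) : ℂ) ^ z = (t : ℂ) ^ (z / 2) := by
  rw [Complex.cpow_def_of_ne_zero (by exact_mod_cast (Real.sqrt_pos.2 ht).ne'),
    Complex.cpow_def_of_ne_zero (by exact_mod_cast ht.ne'), ← Complex.ofReal_log (Real.sqrt_nonneg t),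
    ← Complex.ofReal_log ht.le, Real.log_sqrt ht.le]
  push_cast
  ring_nf

/-- The law of `√τ · N` where `τ` has density `p` and `N` is an independent standard Gaussian. -/
noncomputable def scaledGaussian (p : ℝ → ℝ) : Measure ℝ :=
  ((volume.withDensity fun t => ENNReal.ofReal (p t)).prod (gaussianReal 0 1)).map
    (fun q => √q.1 * q.2)

theorem ae_pos_fst (h0 : volume.withDensity (fun t => ENNReal.ofReal (p t)) (Set.Iic 0) = 0) :
    ∀ᵐ q ∂((volume.withDensity fun t => ENNReal.ofReal (p t)).prod (gaussianReal 0 1)), 0 < q.1 := by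
  have : ∀ᵐ t ∂(volume.withDensity fun t => ENNReal.ofReal (p t)), 0 < t := by
    have : (Set.Iic (0 : ℝ))ᶜ ∈ ae (volume.withDensity (fun t => ENNReal.ofReal (p t))) :=
      compl_mem_ae_iff.2 h0
    filter_upwards [this] with t ht
    simpa using ht
  exact Measure.quasiMeasurePreserving_fst.ae this

theorem scaledGaussian_ae_ne_zero
    (h0 : volume.withDensity (fun t => ENNReal.ofReal (p t)) (Set.Iic 0) = 0) :
    ∀ᵐ y ∂(scaledGaussian p), y ≠ 0 := by
  rw [scaledGaussian, ae_map_iff (by fun_prop)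
    (p := fun y => y ≠ 0) (measurableSet_singleton (0 : ℝ)).compl]
  filter_upwards [ae_pos_fst h0, Measure.quasiMeasurePreserving_snd.ae ae_ne_zero_gaussianReal]
    with q hq hq2
  exact mul_ne_zero (Real.sqrt_pos.2 hq).ne' hq2

theorem abs_cpow_sqrt_mul
    (h0 : volume.withDensity (fun t => ENNReal.ofReal (p t)) (Set.Iic 0) = 0) (z : ℂ) :
    (fun q : ℝ × ℝ => ((|√q.1 * q.2| : ℝ) : ℂ) ^ z) =ᵐ[(volume.withDensity fun t =>
      ENNReal.ofReal (p t)).prod (gaussianReal 0 1)]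
      fun q => (q.1 : ℂ) ^ (z / 2) * ((|q.2| : ℝ) : ℂ) ^ z := by
  filter_upwards [ae_pos_fst h0] with q hq
  rw [abs_mul, abs_of_nonneg (Real.sqrt_nonneg _), Complex.ofReal_mul,
    Complex.mul_cpow_ofReal_nonneg (Real.sqrt_nonneg _) (abs_nonneg _), ofReal_sqrt_cpow hq]

theorem integrable_abs_cpow_scaledGaussian (hpmeas : Measurable p) (hp : ∀ t, 0 ≤ p t)
    (h0 : volume.withDensity (fun t => ENNReal.ofReal (p t)) (Set.Iic 0) = 0) {z : ℂ}
    (hz : -1 < z.re) (hpz : MellinConvergent (fun t => (p t : ℂ)) (z / 2 + 1)) :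
    Integrable (fun y : ℝ => ((|y| : ℝ) : ℂ) ^ z) (scaledGaussian p) := by
  rw [scaledGaussian, integrable_map_measure (measurable_abs_cpow z).aestronglyMeasurable
    (by fun_prop)]
  exact ((integrable_cpow_withDensity hpmeas hp h0 hpz).mul_prod
    (integrable_abs_cpow_gaussianReal hz)).congr (abs_cpow_sqrt_mul h0 z).symm

theorem integrable_abs_rpow_scaledGaussian (hpmeas : Measurable p) (hp : ∀ t, 0 ≤ p t)
    (h0 : volume.withDensity (fun t => ENNReal.ofReal (p t)) (Set.Iic 0) = 0) {s : ℝ}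
    (hs : -1 < s) (hps : MellinConvergent (fun t => (p t : ℂ)) (s / 2 + 1)) :
    Integrable (fun y : ℝ => |y| ^ s) (scaledGaussian p) := by
  refine (integrable_abs_cpow_scaledGaussian hpmeas hp h0 (z := s) (by simpa) hps).re.congr
    (Eventually.of_forall fun y => ?_)
  beta_reduce
  rw [← Complex.ofReal_cpow (abs_nonneg y)]
  simp

theorem integral_abs_cpow_scaledGaussian (hpmeas : Measurable p) (hp : ∀ t, 0 ≤ p t)
    (h0 : volume.withDensity (fun t => ENNReal.ofReal (p t)) (Set.Iic 0) = 0) (z : ℂ) :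
    ∫ y : ℝ, ((|y| : ℝ) : ℂ) ^ z ∂(scaledGaussian p) =
      mellin (fun t => (p t : ℂ)) (z / 2 + 1) * ∫ y : ℝ, ((|y| : ℝ) : ℂ) ^ z ∂(gaussianReal 0 1) := by
  rw [scaledGaussian, integral_map (by fun_prop) (measurable_abs_cpow z).aestronglyMeasurable,
    integral_congr_ae (abs_cpow_sqrt_mul h0 z),
    integral_prod_mul (fun t : ℝ => (t : ℂ) ^ (z / 2)) (fun y : ℝ => ((|y| : ℝ) : ℂ) ^ z),
    integral_cpow_withDensity hpmeas hp h0]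

/-- The moment factors into a Mellin transform of `p` and a Gaussian moment. Riemann-Lebesgue kills
the first factor; the second has modulus at most the absolute moment of order `s`, whatever `u` is.
-/
theorem tendsto_integral_abs_cpow_scaledGaussian (hpmeas : Measurable p) (hp : ∀ t, 0 ≤ p t)
    (h0 : volume.withDensity (fun t => ENNReal.ofReal (p t)) (Set.Iic 0) = 0) {s : ℝ} :
    Tendsto (fun u : ℝ => ∫ y : ℝ, ((|y| : ℝ) : ℂ) ^ (s + u * Complex.I : ℂ) ∂(scaledGaussian p))
      atTop (𝓝 0) := by
  simp only [integral_abs_cpow_scaledGaussian hpmeas hp h0]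
  have h1 : Tendsto (fun u : ℝ => mellin (fun t => (p t : ℂ)) ((s + u * Complex.I : ℂ) / 2 + 1))
      atTop (𝓝 0) := by
    refine ((tendsto_mellin_vertical (fun t => (p t : ℂ)) (s / 2 + 1)).comp
      (tendsto_id.atTop_div_const (two_pos))).congr fun u => ?_
    simp only [Function.comp, id]
    congr 1
    push_cast
    ring
  refine h1.zero_mul_isBoundedUnder_le ⟨∫ y : ℝ, |y| ^ s ∂(gaussianReal 0 1), ?_⟩
  refine eventually_map.2 (Eventually.of_forall fun u => ?_)
  refine (norm_integral_le_integral_norm _).trans_eq (integral_congr_ae ?_)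
  filter_upwards [ae_ne_zero_gaussianReal] with y hy
  rw [norm_ofReal_cpow_of_ne_zero hy]
  simp

theorem abs_log_le_rpow_add_rpow {u δ : ℝ} (hu : 0 < u) (hδ : 0 < δ) :
    |Real.log u| ≤ δ⁻¹ * (u ^ δ + u ^ (-δ)) := by
  have h1 := Real.log_le_rpow_div hu.le hδ
  have h2 := Real.log_le_rpow_div (inv_pos.2 hu).le hδ
  rw [Real.log_inv, Real.inv_rpow hu.le, ← Real.rpow_neg hu.le] at h2
  have h3 : 0 < u ^ δ / δ := by positivity
  have h4 : 0 < u ^ (-δ) / δ := by positivity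
  rw [mul_add, ← div_eq_inv_mul, ← div_eq_inv_mul, abs_le]
  constructor <;> linarith

/-- A logarithm costs an arbitrarily small power on either side. Using `δ = ε/2` in the logarithm
bound makes its square cost exactly `|y|^(±ε)`; the factor `2` in `b` comes from `log y² = 2 log
|y|`. -/
theorem integrable_one_add_abs_log_sq_mul_rpow {μ : Measure ℝ} {s ε κ : ℝ} (hε : 0 < ε)
    (hκ : 0 < κ) (h0 : ∀ᵐ y ∂μ, y ≠ 0) (h1 : Integrable (fun y : ℝ => |y| ^ s) μ)
    (h2 : Integrable (fun y : ℝ => |y| ^ (s + ε)) μ)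
    (h3 : Integrable (fun y : ℝ => |y| ^ (s - ε)) μ) :
    Integrable (fun y : ℝ => (1 + |Real.log (y ^ 2 / κ)|) ^ 2 * |y| ^ s) μ := by
  set A := 1 + |Real.log κ| with hA
  set b := 2 * (ε / 2)⁻¹ with hb
  have hint := ((h1.const_mul (3 * A ^ 2)).add (h2.const_mul (3 * b ^ 2))).add
    (h3.const_mul (3 * b ^ 2))
  refine hint.mono' (Measurable.aestronglyMeasurable (by fun_prop)) ?_
  filter_upwards [h0] with y hy
  have hu : 0 < |y| := abs_pos.2 hy
  have e1 : |y| ^ (s + ε) = |y| ^ s * (|y| ^ (ε / 2)) ^ 2 := by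
    rw [← Real.rpow_natCast, ← Real.rpow_mul hu.le, ← Real.rpow_add hu]
    congr 1; push_cast; ring
  have e2 : |y| ^ (s - ε) = |y| ^ s * (|y| ^ (-(ε / 2))) ^ 2 := by
    rw [← Real.rpow_natCast, ← Real.rpow_mul hu.le, ← Real.rpow_add hu]
    congr 1; push_cast; ring
  have hlog : |Real.log (y ^ 2 / κ)| ≤ |Real.log κ| + b * (|y| ^ (ε / 2) + |y| ^ (-(ε / 2))) := by
    rw [Real.log_div (pow_ne_zero 2 hy) hκ.ne', ← sq_abs, Real.log_pow]
    have := abs_log_le_rpow_add_rpow hu (half_pos hε)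
    refine (abs_sub _ _).trans ?_
    rw [abs_mul, Nat.cast_ofNat, abs_two, hb, add_comm]
    linarith
  have hs : 0 < |y| ^ s := by positivity
  have hP : 0 < |y| ^ (ε / 2) := by positivity
  have hQ : 0 < |y| ^ (-(ε / 2)) := by positivity
  rw [Real.norm_of_nonneg (by positivity)]
  simp only [Pi.add_apply]
  rw [e1, e2]
  generalize |y| ^ (ε / 2) = p at *
  generalize |y| ^ (-(ε / 2)) = q at *
  have hle : (1 + |Real.log (y ^ 2 / κ)|) ^ 2 ≤ 3 * A ^ 2 + 3 * b ^ 2 * p ^ 2 + 3 * b ^ 2 * q ^ 2 := by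
    have h : (1 + |Real.log (y ^ 2 / κ)|) ^ 2 ≤ (A + b * p + b * q) ^ 2 := by
      refine pow_le_pow_left₀ (by positivity) ?_ 2
      rw [hA]; linarith
    nlinarith [sq_nonneg (A - b * p), sq_nonneg (A - b * q), sq_nonneg (b * p - b * q)]
  calc _ ≤ (3 * A ^ 2 + 3 * b ^ 2 * p ^ 2 + 3 * b ^ 2 * q ^ 2) * |y| ^ s := by gcongr
    _ = _ := by ring

end

/-! ### Stirling's formula for the complex Gamma function on vertical lines -/

/-- The exponent `(s - 1/2) log s - s` in Stirling's formula. -/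
noncomputable def stirlingExp (s : ℂ) : ℂ := (s - 1 / 2) * Complex.log s - s

/-- The error `(s + 1/2) log (1 + 1/s) - 1` made by `stirlingExp` in one step of the recursion. -/
noncomputable def stirlingStep (s : ℂ) : ℂ := (s + 1 / 2) * Complex.log (1 + s⁻¹) - 1

/-- Both `s` and `1 + 1/s` lie in the right half-plane, so their arguments add up to less than `π`
in modulus and the principal logarithm is additive. -/
theorem log_add_one_of_re_pos {s : ℂ} (hs : 0 < s.re) :
    Complex.log (s + 1) = Complex.log s + Complex.log (1 + s⁻¹) := by
  have hs0 : s ≠ 0 := by rintro rfl; simp at hs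
  have hinv : 0 < (1 + s⁻¹).re := by
    have : 0 < (s⁻¹).re := by
      rw [Complex.inv_re]; exact div_pos hs (Complex.normSq_pos.2 hs0)
    rw [Complex.add_re, Complex.one_re]; linarith
  have h1 : (1 + s⁻¹) ≠ 0 := by intro h; rw [h] at hinv; simp at hinv
  have a1 := abs_lt.1 (Complex.abs_arg_lt_pi_div_two_iff.2 (Or.inl hs))
  have a2 := abs_lt.1 (Complex.abs_arg_lt_pi_div_two_iff.2 (Or.inl hinv))
  rw [← Complex.log_mul hs0 h1 ⟨by linarith [a1.1, a2.1], by linarith [a1.2, a2.2]⟩]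
  congr 1
  field_simp

theorem stirlingExp_add_one {s : ℂ} (hs : 0 < s.re) :
    stirlingExp (s + 1) = stirlingExp s + Complex.log s + stirlingStep s := by
  rw [stirlingExp, stirlingExp, stirlingStep, log_add_one_of_re_pos hs]
  ring

/-- With `w = 1/s`, `(1/w + 1/2)(w - w²/2) - 1 = -w²/4`: the linear terms cancel thanks to the shift
by `1/2`, and the cubic remainder of the logarithm also contributes order `w²`. Quadratic decay is
what makes the errors summable along `s + k`. -/
theorem norm_stirlingStep_le {s : ℂ} (hs : 2 ≤ ‖s‖) : ‖stirlingStep s‖ ≤ 2 / ‖s‖ ^ 2 := by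
  have hs0 : s ≠ 0 := by rintro rfl; simp at hs; linarith
  set w := s⁻¹ with hw
  have hsw : s = w⁻¹ := by rw [hw, inv_inv]
  have hw0 : w ≠ 0 := inv_ne_zero hs0
  have hn : ‖w‖ ≤ 1 / 2 := by
    rw [hw, norm_inv, one_div]; exact inv_anti₀ two_pos hs
  have hn0 : 0 < ‖w‖ := norm_pos_iff.2 hw0
  have h3 := Complex.norm_log_sub_logTaylor_le 2 (z := w) (by linarith)
  have e3 : Complex.logTaylor (2 + 1) w = w - w ^ 2 / 2 := by
    simp [Complex.logTaylor, Finset.sum_range_succ]; ring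
  rw [e3] at h3
  set r := Complex.log (1 + w) - (w - w ^ 2 / 2) with hr
  have hrn : ‖r‖ ≤ ‖w‖ ^ 3 := by
    refine h3.trans ?_
    have : (1 - ‖w‖)⁻¹ ≤ 2 := by
      rw [inv_le_comm₀ (by linarith) two_pos]; linarith
    norm_num
    rw [div_le_iff₀ (by norm_num)]
    have : ‖w‖ ^ 3 * (1 - ‖w‖)⁻¹ ≤ ‖w‖ ^ 3 * 2 := by gcongr
    nlinarith [pow_pos hn0 3]
  have e : stirlingStep s = -(w ^ 2 / 4) + (w⁻¹ + 1 / 2) * r := by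
    rw [stirlingStep, ← hw, hr, hsw]
    field_simp
    ring
  have e2 : ‖s‖ = ‖w‖⁻¹ := by rw [hsw, norm_inv]
  rw [e, e2]
  calc ‖-(w ^ 2 / 4) + (w⁻¹ + 1 / 2) * r‖ ≤ ‖w‖ ^ 2 / 4 + (‖w‖⁻¹ + 1 / 2) * ‖w‖ ^ 3 := by
        refine (norm_add_le _ _).trans (add_le_add ?_ ?_)
        · rw [norm_neg, norm_div, norm_pow]; norm_num
        · rw [norm_mul]
          gcongr
          refine (norm_add_le _ _).trans ?_
          rw [norm_inv]; norm_num
    _ = ‖w‖ ^ 2 * (5 / 4 + ‖w‖ / 2) := by field_simp; ring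
    _ ≤ ‖w‖ ^ 2 * 2 := by gcongr; linarith
    _ = 2 / ‖w‖⁻¹ ^ 2 := by field_simp

/-- The quotient of the two sides of Stirling's formula, up to the constant. -/
noncomputable def stirlingRatio (s : ℂ) : ℂ := Complex.Gamma s * Complex.exp (-stirlingExp s)

theorem stirlingRatio_add_one {s : ℂ} (hs : 0 < s.re) :
    stirlingRatio s = stirlingRatio (s + 1) * Complex.exp (stirlingStep s) := by
  have hs0 : s ≠ 0 := by rintro rfl; simp at hs
  rw [stirlingRatio, stirlingRatio, Complex.Gamma_add_one s hs0, stirlingExp_add_one hs,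
    mul_assoc, ← Complex.exp_add]
  have : -(stirlingExp s + Complex.log s + stirlingStep s) + stirlingStep s
      = -stirlingExp s + -Complex.log s := by ring
  rw [this, Complex.exp_add, Complex.exp_neg (Complex.log s), Complex.exp_log hs0]
  field_simp

theorem stirlingRatio_add_natCast {s : ℂ} (hs : 0 < s.re) (n : ℕ) :
    stirlingRatio s = stirlingRatio (s + n) *
      Complex.exp (∑ k ∈ Finset.range n, stirlingStep (s + k)) := by
  induction n with
  | zero => simp
  | succ n ih =>
    rw [ih, stirlingRatio_add_one (s := s + n) (by simp; positivity), Finset.sum_range_succ,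
      add_comm (∑ k ∈ Finset.range n, stirlingStep (s + k)), Complex.exp_add]
    push_cast
    rw [add_assoc, mul_assoc]

theorem Gamma_add_natCast {s : ℂ} (hs : 0 < s.re) (n : ℕ) :
    Complex.Gamma (s + n) = Complex.Gamma s * ∏ j ∈ Finset.range n, (s + j) := by
  induction n with
  | zero => simp
  | succ n ih =>
    have : s + n ≠ 0 := by
      intro h
      have := congrArg Complex.re h
      simp at this
      linarith [Nat.cast_nonneg (α := ℝ) n]
    push_cast
    rw [← add_assoc, Complex.Gamma_add_one _ this, ih, Finset.prod_range_succ]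
    ring

/-- The constant in Stirling's formula is found along integer translates, where Euler's limit
`GammaSeq` reduces `Γ(s+n+1)` to `n! n^s` and the real Stirling formula applies to `n!`. The shift
is `n + 1` because the product in `GammaSeq s n` has `n + 1` factors. -/
theorem tendsto_stirlingRatio {s : ℂ} (hs : 0 < s.re) :
    Tendsto (fun n : ℕ => stirlingRatio (s + (n + 1 : ℕ))) atTop
      (𝓝 ((√2 * √Real.pi : ℝ) : ℂ)) := by
  set ε : ℕ → ℂ := fun n => s + 1 - (n + (s + 1 / 2)) * Complex.log (1 + (s + 1) / n) with hε
  have hΓ : Complex.Gamma s ≠ 0 := Complex.Gamma_ne_zero_of_re_pos hs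
  have hg : Tendsto (fun n : ℕ => (n : ℂ) * Complex.log (1 + (s + 1) / n)) atTop (𝓝 (s + 1)) := by
    refine Complex.tendsto_nat_mul_log_one_add_of_tendsto (tendsto_const_nhds.congr' ?_)
    filter_upwards [eventually_gt_atTop 0] with n hn
    have : (n : ℂ) ≠ 0 := by exact_mod_cast hn.ne'
    field_simp
  have hinv : Tendsto (fun n : ℕ => ((n : ℂ))⁻¹) atTop (𝓝 0) := tendsto_inv_atTop_nhds_zero_nat
  have hlog : Tendsto (fun n : ℕ => Complex.log (1 + (s + 1) / n)) atTop (𝓝 0) := by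
    have := hinv.mul hg
    rw [zero_mul] at this
    refine this.congr' ?_
    filter_upwards [eventually_gt_atTop 0] with n hn
    have : (n : ℂ) ≠ 0 := by exact_mod_cast hn.ne'
    field_simp
  have hε0 : Tendsto ε atTop (𝓝 0) := by
    have := (tendsto_const_nhds (x := s + 1)).sub (hg.add (hlog.const_mul (s + 1 / 2)))
    simp only [mul_zero, add_zero, sub_self] at this
    refine this.congr fun n => ?_
    simp only [hε]
    ring
  have hlim : Tendsto (fun n : ℕ => Complex.Gamma s / Complex.GammaSeq s n *
      (√2 * Stirling.stirlingSeq n : ℝ) * Complex.exp (ε n)) atTop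
      (𝓝 ((√2 * √Real.pi : ℝ) : ℂ)) := by
    have h1 := (tendsto_const_nhds (x := Complex.Gamma s)).div
      (Complex.GammaSeq_tendsto_Gamma s) hΓ
    have h2 := (Complex.continuous_ofReal.tendsto _).comp
      (Stirling.tendsto_stirlingSeq_sqrt_pi.const_mul √2)
    have h3 := (Complex.continuous_exp.tendsto _).comp hε0
    have := (h1.mul h2).mul h3
    rw [div_self hΓ, one_mul, Complex.exp_zero, mul_one] at this
    exact this
  refine hlim.congr' ?_
  filter_upwards [eventually_gt_atTop 0] with n hn
  have hnR : (0 : ℝ) < n := by exact_mod_cast hn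
  have hn0 : (n : ℂ) ≠ 0 := by exact_mod_cast hn.ne'
  have hprod : ∏ j ∈ Finset.range (n + 1), (s + j) ≠ 0 := by
    refine Finset.prod_ne_zero_iff.2 fun j _ h => ?_
    have := congrArg Complex.re h
    simp at this
    linarith [Nat.cast_nonneg (α := ℝ) j]
  have hns : (n : ℂ) ^ s = Complex.exp (s * Real.log n) := by
    rw [Complex.cpow_def_of_ne_zero hn0, ← Complex.natCast_log]
    ring_nf
  have hfac : (n.factorial : ℂ) = (√2 * Stirling.stirlingSeq n : ℝ)
      * Complex.exp ((n + 1 / 2) * Real.log n - n) := by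
    have h1 : (n.factorial : ℝ) = √2 * Stirling.stirlingSeq n
        * Real.exp ((n + 1 / 2) * Real.log n - n) := by
      have e1 : √(n : ℝ) = Real.exp (1 / 2 * Real.log n) := by
        rw [Real.sqrt_eq_rpow, Real.rpow_def_of_pos hnR]; ring_nf
      have e2 : ((n : ℝ) / Real.exp 1) ^ n = Real.exp (n * Real.log n - n) := by
        rw [← Real.exp_log hnR, ← Real.exp_sub, ← Real.exp_nat_mul, Real.exp_log hnR]
        ring_nf
      have e3 : Real.exp ((n + 1 / 2) * Real.log n - n) = √(n : ℝ) * (n / Real.exp 1) ^ n := by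
        rw [e1, e2, ← Real.exp_add]; ring_nf
      rw [e3, Stirling.stirlingSeq, Real.sqrt_mul two_pos.le]
      have : √(n : ℝ) ≠ 0 := (Real.sqrt_pos.2 hnR).ne'
      field_simp
    have := congrArg (fun x : ℝ => (x : ℂ)) h1
    push_cast at this ⊢
    exact this
  have hs1 : s + (n + 1 : ℕ) ≠ 0 := by
    intro h
    have := congrArg Complex.re h
    simp at this
    linarith
  have hlogs : Complex.log (s + (n + 1 : ℕ)) = Real.log n + Complex.log (1 + (s + 1) / n) := by
    have e : s + (n + 1 : ℕ) = ((n : ℝ) : ℂ) * (1 + (s + 1) / n) := by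
      push_cast; field_simp; ring
    have h1 : 1 + (s + 1) / n ≠ 0 := by
      intro h; rw [e, h, mul_zero] at hs1; exact hs1 rfl
    rw [e, Complex.log_ofReal_mul hnR h1]
  have hexp : Complex.exp (ε n) * (Complex.exp (s * Real.log n)
      * Complex.exp ((n + 1 / 2) * Real.log n - n))⁻¹
      = Complex.exp (-stirlingExp (s + (n + 1 : ℕ))) := by
    rw [← Complex.exp_add, ← Complex.exp_neg, ← Complex.exp_add, stirlingExp, hlogs]
    congr 1
    simp only [hε]
    push_cast
    ring
  have hst : ((√2 * Stirling.stirlingSeq n : ℝ) : ℂ) ≠ 0 := by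
    intro h
    rw [h, zero_mul] at hfac
    exact Nat.factorial_ne_zero n (by exact_mod_cast hfac)
  rw [stirlingRatio, Gamma_add_natCast hs, ← hexp, Complex.GammaSeq, hfac, hns]
  have he1 := Complex.exp_ne_zero (s * Real.log n)
  have he2 := Complex.exp_ne_zero ((n + 1 / 2) * Real.log n - n)
  field_simp

/-- Since `(k+v)² ≤ 2(k²+v²)`, each term is at most `2 / ((k+v-1)(k+v))`, which telescopes. -/
theorem sum_inv_sq_add_sq_le {v : ℝ} (hv : 2 ≤ v) (n : ℕ) :
    ∑ k ∈ Finset.range n, 1 / ((k : ℝ) ^ 2 + v ^ 2) ≤ 4 / v := by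
  have h : ∀ n : ℕ, ∑ k ∈ Finset.range n, 1 / ((k : ℝ) ^ 2 + v ^ 2)
      ≤ 2 / (v - 1) - 2 / (n + v - 1) := by
    intro n
    induction n with
    | zero => simp
    | succ n ih =>
      rw [Finset.sum_range_succ]
      have hn : (0 : ℝ) ≤ n := Nat.cast_nonneg n
      have h1 : 1 / ((n : ℝ) ^ 2 + v ^ 2) ≤ 2 / (n + v - 1) - 2 / (n + v) := by
        rw [div_sub_div _ _ (by linarith) (by linarith), div_le_div_iff₀ (by positivity)
          (by nlinarith)]
        nlinarith [sq_nonneg ((n : ℝ) - v)]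
      push_cast
      have e : (n : ℝ) + 1 + v - 1 = n + v := by ring
      rw [e]
      linarith
  refine (h n).trans ?_
  have hn : (0 : ℝ) ≤ n := Nat.cast_nonneg n
  have h2 : 0 ≤ 2 / ((n : ℝ) + v - 1) := div_nonneg two_pos.le (by linarith)
  have h3 : 2 / (v - 1) ≤ 4 / v := by
    rw [div_le_div_iff₀ (by linarith) (by linarith)]; linarith
  linarith

/-- Moving from `s` to `s + n` multiplies the ratio by the exponential of a sum of step errors,
which is at most `8/v` in modulus for every `n`. Letting `n → ∞` compares the ratio at `s` with
`√(2π)`; `8 ≤ v` keeps the exponent in the range where `|e^z - 1| ≤ 2|z|`. -/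
theorem norm_inv_stirlingRatio_sub_le {c v : ℝ} (hc : 0 < c) (hv : 8 ≤ v) :
    ‖(stirlingRatio (c + Complex.I * v))⁻¹ - ((√2 * √Real.pi : ℝ) : ℂ)⁻¹‖
      ≤ 16 / v * ‖((√2 * √Real.pi : ℝ) : ℂ)⁻¹‖ := by
  set s : ℂ := c + Complex.I * v with hs
  set K : ℂ := ((√2 * √Real.pi : ℝ) : ℂ) with hK
  have hsre : s.re = c := by simp [hs]
  have hsim : s.im = v := by simp [hs]
  have hK0 : K ≠ 0 := by
    rw [hK]; exact_mod_cast (by positivity : √2 * √Real.pi ≠ 0)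
  have hstep : ∀ k : ℕ, ‖stirlingStep (s + k)‖ ≤ 2 * (1 / ((k : ℝ) ^ 2 + v ^ 2)) := by
    intro k
    have hsq : ‖s + k‖ ^ 2 = (c + k) ^ 2 + v ^ 2 := by
      rw [← Complex.normSq_eq_norm_sq, Complex.normSq_apply]
      simp [hsre, hsim]; ring
    have hk : (0 : ℝ) ≤ k := Nat.cast_nonneg k
    have h2 : 2 ≤ ‖s + k‖ := by
      refine le_trans ?_ (Complex.abs_im_le_norm (s + k))
      simp only [Complex.add_im, hsim, Complex.natCast_im, add_zero]
      linarith [le_abs_self v]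
    refine (norm_stirlingStep_le h2).trans ?_
    rw [hsq, mul_one_div]
    gcongr
    linarith
  have hsum : ∀ n : ℕ, ‖∑ k ∈ Finset.range n, stirlingStep (s + k)‖ ≤ 8 / v := by
    intro n
    refine (norm_sum_le _ _).trans ((Finset.sum_le_sum fun k _ => hstep k).trans ?_)
    rw [← Finset.mul_sum]
    have := sum_inv_sq_add_sq_le (v := v) (by linarith) n
    calc _ ≤ 2 * (4 / v) := by gcongr
      _ = 8 / v := by ring
  have hlim := (tendsto_stirlingRatio (s := s) (by rw [hsre]; exact hc)).inv₀ hK0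
  have hl2 : Tendsto (fun n : ℕ => ‖(stirlingRatio s)⁻¹ - (stirlingRatio (s + (n + 1 : ℕ)))⁻¹‖)
      atTop (𝓝 ‖(stirlingRatio s)⁻¹ - K⁻¹‖) := (tendsto_const_nhds.sub hlim).norm
  have hl3 := (hlim.norm).const_mul (16 / v)
  refine le_of_tendsto_of_tendsto' hl2 hl3 fun n => ?_
  rw [stirlingRatio_add_natCast (s := s) (by rw [hsre]; exact hc) (n + 1), mul_inv,
    ← Complex.exp_neg]
  set σ := ∑ k ∈ Finset.range (n + 1), stirlingStep (s + k)
  have hσ : ‖-σ‖ ≤ 8 / v := by rw [norm_neg]; exact hsum _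
  have h8 : 8 / v ≤ 1 := (div_le_one (by linarith)).2 hv
  have := Complex.norm_exp_sub_one_le (hσ.trans h8)
  have e : ∀ b : ℂ, b * Complex.exp (-σ) - b = (Complex.exp (-σ) - 1) * b := fun b => by ring
  rw [e, norm_mul]
  gcongr
  calc _ ≤ 2 * ‖-σ‖ := this
    _ ≤ 2 * (8 / v) := by gcongr
    _ = 16 / v := by ring

/-! ### The truncated Fourier integral of the reciprocal Gamma function on a vertical line -/

theorem one_add_rpow_le_exp {b u : ℝ} (hb : 0 < b) (hu : 0 ≤ u) :
    (1 + u) ^ b ≤ (2 * b) ^ b * Real.exp (1 / 2) * Real.exp (u / 2) := by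
  have h1 : (1 + u) / (2 * b) ≤ Real.exp ((1 + u) / (2 * b)) :=
    (by linarith : (1 + u) / (2 * b) ≤ (1 + u) / (2 * b) + 1).trans (Real.add_one_le_exp _)
  have h2 := Real.rpow_le_rpow (by positivity) h1 hb.le
  rw [Real.div_rpow (by positivity) (by positivity), div_le_iff₀ (by positivity),
    ← Real.exp_mul] at h2
  refine h2.trans_eq ?_
  rw [mul_assoc, ← Real.exp_add, mul_comm]
  congr 2
  field_simp

theorem rpow_le_rpow_mul_one_add_sub {a v R : ℝ} (hv : 1 ≤ v) (hvR : v ≤ R) :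
    v ^ a ≤ R ^ a * (1 + (R - v)) ^ (|a| + 1) := by
  have hv0 : 0 < v := by linarith
  have hR0 : 0 < R := by linarith
  have h1 : 1 ≤ 1 + (R - v) := by linarith
  rcases le_total 0 a with ha | ha
  · calc v ^ a ≤ R ^ a := Real.rpow_le_rpow hv0.le hvR ha
      _ ≤ _ := le_mul_of_one_le_right (by positivity) (Real.one_le_rpow h1 (by positivity))
  · have h2 : R / v ≤ 1 + (R - v) := by
      rw [div_le_iff₀ hv0]; nlinarith
    have h3 : v ^ a = R ^ a * (R / v) ^ (-a) := by
      rw [Real.rpow_neg (by positivity), Real.div_rpow hR0.le hv0.le]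
      field_simp
    rw [h3, abs_of_nonpos ha]
    gcongr
    calc (R / v) ^ (-a) ≤ (1 + (R - v)) ^ (-a) :=
          Real.rpow_le_rpow (by positivity) h2 (by linarith)
      _ ≤ _ := Real.rpow_le_rpow_of_exponent_le h1 (by linarith)

/-- Relative to its value at `R`, the power changes by at most a power of `1 + (R - v)`, which part
of the exponential decay away from `R` absorbs. The exponent `|a| + 1` is used instead of `|a|` so
that it is positive also for `a = 0`. -/
theorem exists_integral_rpow_mul_exp_le (a : ℝ) :
    ∃ C, 0 < C ∧ ∀ V R : ℝ, 1 ≤ V → V ≤ R →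
      ∫ v in V..R, v ^ a * Real.exp (Real.pi / 2 * v) ≤ C * (R ^ a * Real.exp (Real.pi / 2 * R)) := by
  set b := |a| + 1 with hb
  have hb0 : 0 < b := by positivity
  refine ⟨(2 * b) ^ b * Real.exp (1 / 2), by positivity, fun V R hV hVR => ?_⟩
  set D := (2 * b) ^ b * Real.exp (1 / 2) * (R ^ a * Real.exp (Real.pi / 2 * R)) with hD
  have hR0 : 0 < R := by linarith
  have hD0 : 0 ≤ D := by positivity
  have hcont : ContinuousOn (fun v : ℝ => v ^ a * Real.exp (Real.pi / 2 * v)) (Set.uIcc V R) := by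
    refine ContinuousOn.mul (ContinuousOn.rpow_const continuousOn_id fun v hv => Or.inl ?_)
      (by fun_prop)
    rw [Set.uIcc_of_le hVR] at hv
    have := hv.1
    exact (by linarith : (0 : ℝ) < v).ne'
  have hle : ∀ v ∈ Set.Icc V R, v ^ a * Real.exp (Real.pi / 2 * v) ≤ D * Real.exp (v - R) := by
    intro v hv
    have h1 := rpow_le_rpow_mul_one_add_sub (a := a) (hV.trans hv.1) hv.2
    have h2 := one_add_rpow_le_exp hb0 (sub_nonneg.2 hv.2)
    -- Because `π/2 > 3/2`, giving up `e^((R-v)/2)` to the power still leaves an integrable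
    -- `e^(v-R)`.
    have h3 : Real.exp ((R - v) / 2) * Real.exp (Real.pi / 2 * v)
        ≤ Real.exp (Real.pi / 2 * R) * Real.exp (v - R) := by
      rw [← Real.exp_add, ← Real.exp_add]
      refine Real.exp_le_exp.2 ?_
      nlinarith [Real.pi_gt_three, hv.2]
    calc v ^ a * Real.exp (Real.pi / 2 * v)
        ≤ (R ^ a * ((2 * b) ^ b * Real.exp (1 / 2) * Real.exp ((R - v) / 2)))
          * Real.exp (Real.pi / 2 * v) := by
          gcongr
          exact h1.trans (by gcongr)
      _ = (R ^ a * ((2 * b) ^ b * Real.exp (1 / 2))) *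
          (Real.exp ((R - v) / 2) * Real.exp (Real.pi / 2 * v)) := by ring
      _ ≤ (R ^ a * ((2 * b) ^ b * Real.exp (1 / 2))) *
          (Real.exp (Real.pi / 2 * R) * Real.exp (v - R)) := by gcongr
      _ = D * Real.exp (v - R) := by rw [hD]; ring
  calc ∫ v in V..R, v ^ a * Real.exp (Real.pi / 2 * v)
      ≤ ∫ v in V..R, D * Real.exp (v - R) :=
        intervalIntegral.integral_mono_on hVR hcont.intervalIntegrable
          (Continuous.intervalIntegrable (by fun_prop) _ _) hle
    _ = D * (1 - Real.exp (V - R)) := by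
        rw [intervalIntegral.integral_const_mul,
          intervalIntegral.integral_comp_sub_right (fun x => Real.exp x) R, integral_exp]
        simp
    _ ≤ D * 1 := by gcongr; linarith [Real.exp_pos (V - R)]
    _ = _ := by rw [mul_one]

/-- The main term `exp (-(s - 1/2) log s + s)` of `√(2π) / Γ(s)` on the line `s = c + iv`. -/
noncomputable def recipGammaMain (c v : ℝ) : ℂ := Complex.exp (-stirlingExp (c + Complex.I * v))

/-- The logarithmic derivative in `v` of `exp (i v w)` times the main term of `1 / Γ(c + iv)`. -/
noncomputable def phaseDeriv (c w v : ℝ) : ℂ :=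
  Complex.I * (w - Complex.log (c + Complex.I * v) + 1 / (2 * (c + Complex.I * v)))

theorem log_vertical {c v : ℝ} (hv : 0 < v) :
    Complex.log (c + Complex.I * v) = Real.log v + Complex.I * (Real.pi / 2)
      + Complex.log (1 + -Complex.I * c / v) := by
  have hv0 : (v : ℂ) ≠ 0 := by exact_mod_cast hv.ne'
  have hre : (1 + -Complex.I * c / v).re = 1 := by simp [Complex.div_ofReal_re]
  have h1 : (1 + -Complex.I * c / v) ≠ 0 := by
    intro h; rw [h] at hre; simp at hre
  have e : (c : ℂ) + Complex.I * v = (v : ℂ) * (Complex.I * (1 + -Complex.I * c / v)) := by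
    field_simp
    linear_combination (c : ℂ) * Complex.I_sq
  have ha := abs_lt.1 (Complex.abs_arg_lt_pi_div_two_iff.2 (Or.inl (hre ▸ one_pos :
    0 < (1 + -Complex.I * c / v).re)))
  rw [e, Complex.log_ofReal_mul hv (mul_ne_zero Complex.I_ne_zero h1),
    Complex.log_mul Complex.I_ne_zero h1, Complex.log_I]
  · ring
  · rw [Complex.arg_I]
    constructor <;> linarith [ha.1, ha.2, Real.pi_pos]

theorem tendsto_mul_log_vertical (c : ℝ) :
    Tendsto (fun v : ℝ => (v : ℂ) * Complex.log (1 + -Complex.I * c / v)) atTop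
      (𝓝 (-Complex.I * c)) := by
  refine Complex.tendsto_mul_log_one_add_of_tendsto (tendsto_const_nhds.congr' ?_)
  filter_upwards [eventually_gt_atTop 0] with v hv
  have : (v : ℂ) ≠ 0 := by exact_mod_cast hv.ne'
  field_simp

theorem tendsto_inv_ofReal_atTop : Tendsto (fun v : ℝ => (v : ℂ)⁻¹) atTop (𝓝 0) := by
  have := (Complex.continuous_ofReal.tendsto 0).comp tendsto_inv_atTop_zero
  simpa [Function.comp_def] using this

theorem tendsto_log_vertical (c : ℝ) :
    Tendsto (fun v : ℝ => Complex.log (1 + -Complex.I * c / v)) atTop (𝓝 0) := by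
  have := tendsto_inv_ofReal_atTop.mul (tendsto_mul_log_vertical c)
  rw [zero_mul] at this
  refine this.congr' ?_
  filter_upwards [eventually_gt_atTop 0] with v hv
  have : (v : ℂ) ≠ 0 := by exact_mod_cast hv.ne'
  field_simp

theorem norm_recipGammaMain {c v : ℝ} (hv : 0 < v) :
    ‖recipGammaMain c v‖ = v ^ (1 / 2 - c) * Real.exp (Real.pi / 2 * v) *
      ‖Complex.exp (-(Complex.I * (v * Complex.log (1 + -Complex.I * c / v))
        + (c - 1 / 2) * Complex.log (1 + -Complex.I * c / v) - c))‖ := by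
  rw [recipGammaMain, stirlingExp, log_vertical hv, Complex.norm_exp, Complex.norm_exp,
    Real.rpow_def_of_pos hv, ← Real.exp_add, ← Real.exp_add]
  congr 1
  generalize Complex.log (1 + -Complex.I * c / v) = ℓ
  simp
  ring

/-- The remaining exponent tends to zero because `i v log(1 - ic/v) → c` cancels the constant `-c`.
-/
theorem tendsto_norm_recipGammaMain_div (c : ℝ) :
    Tendsto (fun v : ℝ => ‖recipGammaMain c v‖ / (v ^ (1 / 2 - c) * Real.exp (Real.pi / 2 * v)))
      atTop (𝓝 1) := by
  have h := (((tendsto_mul_log_vertical c).const_mul Complex.I).add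
    ((tendsto_log_vertical c).const_mul ((c : ℂ) - 1 / 2))).sub_const (c : ℂ)
  have e : Complex.I * (-Complex.I * c) + ((c : ℂ) - 1 / 2) * 0 - c = 0 := by
    linear_combination (-(c : ℂ)) * Complex.I_sq
  rw [e] at h
  have h2 := ((Complex.continuous_exp.tendsto _).comp h.neg).norm
  simp only [neg_zero, Complex.exp_zero, norm_one] at h2
  refine h2.congr' ?_
  filter_upwards [eventually_gt_atTop 0] with v hv
  rw [norm_recipGammaMain hv, mul_div_cancel_left₀ _ (by positivity)]
  rfl

theorem phaseDeriv_eq {c w v : ℝ} (hv : 0 < v) :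
    phaseDeriv c w v = Complex.I * (w - Real.log v) + Real.pi / 2 +
      Complex.I * (1 / (2 * (c + Complex.I * v)) - Complex.log (1 + -Complex.I * c / v)) := by
  rw [phaseDeriv, log_vertical hv]
  linear_combination (-(Real.pi : ℂ) / 2) * Complex.I_sq

theorem le_norm_vertical (c v : ℝ) : |v| ≤ ‖(c : ℂ) + Complex.I * v‖ := by
  have := Complex.abs_im_le_norm ((c : ℂ) + Complex.I * v)
  simpa using this

theorem tendsto_phaseDeriv_error (c : ℝ) :
    Tendsto (fun v : ℝ => Complex.I * (1 / (2 * (c + Complex.I * v))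
      - Complex.log (1 + -Complex.I * c / v))) atTop (𝓝 0) := by
  have h1 : Tendsto (fun v : ℝ => (1 : ℂ) / (2 * (c + Complex.I * v))) atTop (𝓝 0) := by
    refine squeeze_zero_norm' ?_ tendsto_inv_atTop_zero
    filter_upwards [eventually_gt_atTop 0] with v hv
    rw [norm_div, norm_one, norm_mul, one_div]
    refine inv_anti₀ hv ?_
    have := le_norm_vertical c v
    rw [abs_of_pos hv] at this
    norm_num
    linarith
  simpa using (h1.sub (tendsto_log_vertical c)).const_mul Complex.I

/-- The real part is close to `π/2` and does not involve `w`, which gives the lower bound `1` even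
where `w = log v`. The imaginary part is close to `w - log v`, which gives the second bound. The
threshold is independent of `w`; all later uniformity rests on this. -/
theorem exists_phaseDeriv_bounds (c : ℝ) : ∃ V₀ : ℝ, 1 ≤ V₀ ∧ ∀ v, V₀ ≤ v → ∀ w,
    1 ≤ ‖phaseDeriv c w v‖ ∧ Real.log v ≤ ‖phaseDeriv c w v‖ + |w| + 1 := by
  have h := (tendsto_phaseDeriv_error c).norm.eventually
    (ge_mem_nhds (by simp : ‖(0 : ℂ)‖ < 1 / 2))
  obtain ⟨V, hV⟩ := eventually_atTop.1 h
  refine ⟨max V 1, le_max_right _ _, fun v hv w => ?_⟩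
  have hv0 : 0 < v := by linarith [le_max_right V 1]
  have hη := hV v ((le_max_left _ _).trans hv)
  rw [phaseDeriv_eq hv0]
  generalize Complex.I * (1 / (2 * (c + Complex.I * v))
      - Complex.log (1 + -Complex.I * c / v)) = η at hη
  have hre := Complex.abs_re_le_norm (Complex.I * (w - Real.log v) + Real.pi / 2 + η)
  have him := Complex.abs_im_le_norm (Complex.I * (w - Real.log v) + Real.pi / 2 + η)
  have e1 : (Complex.I * (w - Real.log v) + Real.pi / 2 + η).re = Real.pi / 2 + η.re := by
    simp
  have e2 : (Complex.I * (w - Real.log v) + Real.pi / 2 + η).im = w - Real.log v + η.im := by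
    simp
  have h1 := abs_le.1 (Complex.abs_re_le_norm η)
  have h2 := abs_le.1 (Complex.abs_im_le_norm η)
  rw [e1] at hre
  rw [e2] at him
  constructor
  · linarith [(abs_le.1 hre).2, Real.pi_gt_three]
  · linarith [(abs_le.1 him).1, le_abs_self w]

theorem tendsto_log_div_phaseDeriv (c w : ℝ) :
    Tendsto (fun v : ℝ => (Real.log v : ℂ) / phaseDeriv c w v) atTop (𝓝 Complex.I) := by
  have hl : Tendsto (fun v : ℝ => ((Real.log v : ℝ) : ℂ)⁻¹) atTop (𝓝 0) :=
    tendsto_inv_ofReal_atTop.comp Real.tendsto_log_atTop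
  have h1 : Tendsto (fun v : ℝ => (Complex.I * w + Real.pi / 2) * ((Real.log v : ℝ) : ℂ)⁻¹
      + -Complex.I + Complex.I * (1 / (2 * (c + Complex.I * v))
        - Complex.log (1 + -Complex.I * c / v)) * ((Real.log v : ℝ) : ℂ)⁻¹) atTop
      (𝓝 (-Complex.I)) := by
    have := ((hl.const_mul (Complex.I * w + Real.pi / 2)).add_const (-Complex.I)).add
      ((tendsto_phaseDeriv_error c).mul hl)
    simpa using this
  have h2 := h1.inv₀ (neg_ne_zero.2 Complex.I_ne_zero)
  rw [inv_neg, Complex.inv_I, neg_neg] at h2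
  refine h2.congr' ?_
  filter_upwards [eventually_gt_atTop 1] with v hv
  have hl0 : ((Real.log v : ℝ) : ℂ) ≠ 0 := by exact_mod_cast (Real.log_pos hv).ne'
  rw [phaseDeriv_eq (by linarith), ← inv_div]
  field_simp
  ring

/-! ### The uniform estimate of the oscillatory integral -/

theorem hasDerivAt_vertical (c v : ℝ) :
    HasDerivAt (fun v : ℝ => (c : ℂ) + Complex.I * v) Complex.I v := by
  simpa using ((Complex.ofRealCLM.hasDerivAt (x := v)).const_mul Complex.I).const_add (c : ℂ)

theorem hasDerivAt_log_vertical {c v : ℝ} (hc : 0 < c) :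
    HasDerivAt (fun v : ℝ => Complex.log (c + Complex.I * v))
      (Complex.I / (c + Complex.I * v)) v :=
  (hasDerivAt_vertical c v).clog_real (Or.inl (by simpa using hc))

theorem vertical_ne_zero_of_pos {c : ℝ} (hc : 0 < c) (v : ℝ) : (c : ℂ) + Complex.I * v ≠ 0 := by
  intro h
  have := congrArg Complex.re h
  simp at this
  exact hc.ne' this

/-- The frequency enters `phaseDeriv` additively, so the derivative is free of `w`; its size
`O(1/v)` yields the gain in the integration by parts. -/
theorem hasDerivAt_phaseDeriv {c : ℝ} (hc : 0 < c) (w v : ℝ) :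
    HasDerivAt (phaseDeriv c w)
      (1 / (c + Complex.I * v) + 1 / (2 * (c + Complex.I * v) ^ 2)) v := by
  have hs := vertical_ne_zero_of_pos hc v
  have h1 := ((hasDerivAt_const v (w : ℂ)).sub (hasDerivAt_log_vertical (v := v) hc)).add
    ((((hasDerivAt_vertical c v).const_mul 2).inv (mul_ne_zero two_ne_zero hs)))
  have h2 := h1.const_mul Complex.I
  refine (h2.congr_of_eventuallyEq (Eventually.of_forall fun u => ?_)).congr_deriv ?_
  · simp [phaseDeriv, Pi.add_apply, Pi.sub_apply]
  · field_simp
    linear_combination (-2 * ((c : ℂ) + Complex.I * v) - 1) * Complex.I_sq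

theorem hasDerivAt_exp_mul_recipGammaMain {c : ℝ} (hc : 0 < c) (w v : ℝ) :
    HasDerivAt (fun v : ℝ => Complex.exp (Complex.I * v * w) * recipGammaMain c v)
      (phaseDeriv c w v * (Complex.exp (Complex.I * v * w) * recipGammaMain c v)) v := by
  have hs := vertical_ne_zero_of_pos hc v
  have h0 : HasDerivAt (fun v : ℝ => Complex.I * v * w) (Complex.I * w) v := by
    simpa using ((Complex.ofRealCLM.hasDerivAt (x := v)).const_mul Complex.I).mul_const (w : ℂ)
  have h1 := (((hasDerivAt_vertical c v).sub_const (1 / 2 : ℂ)).mul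
    (hasDerivAt_log_vertical (v := v) hc)).sub (hasDerivAt_vertical c v)
  have h2 := (h0.cexp).mul (h1.neg.cexp)
  refine (h2.congr_of_eventuallyEq (Eventually.of_forall fun u => ?_)).congr_deriv ?_
  · simp [recipGammaMain, stirlingExp]
  · simp only [recipGammaMain, stirlingExp, phaseDeriv, Pi.neg_apply, Pi.sub_apply, Pi.mul_apply]
    field_simp
    ring

theorem continuous_exp_mul_recipGammaMain {c : ℝ} (hc : 0 < c) (w : ℝ) :
    Continuous fun v : ℝ => Complex.exp (Complex.I * v * w) * recipGammaMain c v :=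
  continuous_iff_continuousAt.2 fun v => (hasDerivAt_exp_mul_recipGammaMain hc w v).continuousAt

theorem norm_exp_mul_recipGammaMain (c w v : ℝ) :
    ‖Complex.exp (Complex.I * v * w) * recipGammaMain c v‖ = ‖recipGammaMain c v‖ := by
  have : Complex.I * v * w = ((v * w : ℝ) : ℂ) * Complex.I := by push_cast; ring
  rw [norm_mul, this, Complex.norm_exp_ofReal_mul_I, one_mul]

/-- If `B' = qB`, then `(B/q)' = B - B q'/q²`; integrate over the interval. -/
theorem integral_exp_mul_recipGammaMain {c : ℝ} (hc : 0 < c) {V R w : ℝ} (hVR : V ≤ R)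
    (hq : ∀ v ∈ Set.Icc V R, phaseDeriv c w v ≠ 0) :
    ∫ v in V..R, Complex.exp (Complex.I * v * w) * recipGammaMain c v =
      Complex.exp (Complex.I * R * w) * recipGammaMain c R / phaseDeriv c w R
      - Complex.exp (Complex.I * V * w) * recipGammaMain c V / phaseDeriv c w V
      + ∫ v in V..R, Complex.exp (Complex.I * v * w) * recipGammaMain c v *
        (1 / (c + Complex.I * v) + 1 / (2 * (c + Complex.I * v) ^ 2)) / phaseDeriv c w v ^ 2 := by
  have hB := continuous_exp_mul_recipGammaMain hc w
  have hqc : Continuous (phaseDeriv c w) :=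
    continuous_iff_continuousAt.2 fun v => (hasDerivAt_phaseDeriv hc w v).continuousAt
  have hs := vertical_ne_zero_of_pos hc
  have hq'c : Continuous fun v : ℝ =>
      1 / ((c : ℂ) + Complex.I * v) + 1 / (2 * ((c : ℂ) + Complex.I * v) ^ 2) := by
    refine (continuous_const.div (by fun_prop) hs).add (continuous_const.div (by fun_prop) ?_)
    exact fun v => mul_ne_zero two_ne_zero (pow_ne_zero 2 (hs v))
  have hint1 : IntervalIntegrable
      (fun v : ℝ => Complex.exp (Complex.I * v * w) * recipGammaMain c v) volume V R :=
    hB.intervalIntegrable _ _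
  have hint2 : IntervalIntegrable (fun v : ℝ => Complex.exp (Complex.I * v * w)
      * recipGammaMain c v * (1 / (c + Complex.I * v) + 1 / (2 * (c + Complex.I * v) ^ 2))
      / phaseDeriv c w v ^ 2) volume V R := by
    refine ContinuousOn.intervalIntegrable ?_
    rw [Set.uIcc_of_le hVR]
    exact (hB.mul hq'c).continuousOn.div (hqc.pow 2).continuousOn
      fun v hv => pow_ne_zero 2 (hq v hv)
  have hder : ∀ v ∈ Set.uIcc V R, HasDerivAt (fun v : ℝ => Complex.exp (Complex.I * v * w)
      * recipGammaMain c v / phaseDeriv c w v)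
      (Complex.exp (Complex.I * v * w) * recipGammaMain c v - Complex.exp (Complex.I * v * w)
        * recipGammaMain c v * (1 / (c + Complex.I * v) + 1 / (2 * (c + Complex.I * v) ^ 2))
        / phaseDeriv c w v ^ 2) v := by
    intro v hv
    rw [Set.uIcc_of_le hVR] at hv
    have hq0 := hq v hv
    refine ((hasDerivAt_exp_mul_recipGammaMain hc w v).div (hasDerivAt_phaseDeriv hc w v)
      hq0).congr_deriv ?_
    rw [sub_div, sq]
    congr 1
    rw [mul_comm (phaseDeriv c w v), mul_assoc, mul_div_assoc, div_self (mul_ne_zero hq0 hq0),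
      mul_one]
  have := intervalIntegral.integral_eq_sub_of_hasDerivAt hder (hint1.sub hint2)
  rw [intervalIntegral.integral_sub hint1 hint2] at this
  linear_combination this

theorem norm_deriv_phaseDeriv_le {c v : ℝ} (hv : 1 ≤ v) :
    ‖1 / ((c : ℂ) + Complex.I * v) + 1 / (2 * ((c : ℂ) + Complex.I * v) ^ 2)‖ ≤ 2 / v := by
  have hs := le_norm_vertical c v
  rw [abs_of_pos (by linarith)] at hs
  have hv0 : 0 < v := by linarith
  have h1 : 1 / ‖(c : ℂ) + Complex.I * v‖ ≤ 1 / v := one_div_le_one_div_of_le hv0 hs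
  have h2 : 1 / (2 * ‖(c : ℂ) + Complex.I * v‖ ^ 2) ≤ 1 / v :=
    one_div_le_one_div_of_le hv0 (by nlinarith)
  refine (norm_add_le _ _).trans ?_
  rw [norm_div, norm_div, norm_mul, norm_pow, norm_one, Complex.norm_ofNat]
  calc _ ≤ 1 / v + 1 / v := add_le_add h1 h2
    _ = 2 / v := by ring

theorem continuous_inv_Gamma_vertical (c : ℝ) :
    Continuous fun v : ℝ => (Complex.Gamma (c + Complex.I * v))⁻¹ :=
  Complex.differentiable_one_div_Gamma.continuous.comp
    (by fun_prop : Continuous fun v : ℝ => (c : ℂ) + Complex.I * v)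

theorem inv_Gamma_eq {c : ℝ} (v : ℝ) :
    (Complex.Gamma (c + Complex.I * v))⁻¹ =
      recipGammaMain c v * (stirlingRatio (c + Complex.I * v))⁻¹ := by
  rw [stirlingRatio, recipGammaMain, mul_inv]
  have := Complex.exp_ne_zero (-stirlingExp (c + Complex.I * v))
  field_simp

/-- The truncated Fourier integral of `1 / Γ` on a vertical line is, uniformly in the frequency,
close to the boundary term at the end of the interval. -/
theorem exists_norm_integral_inv_Gamma_sub_le {c : ℝ} (hc : 0 < c) :
    ∃ V₀ C : ℝ, 1 ≤ V₀ ∧ 0 < C ∧ ∀ R, V₀ ≤ R → ∀ w : ℝ,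
      ‖(∫ v in (0 : ℝ)..R, Complex.exp (Complex.I * v * w) * (Complex.Gamma (c + Complex.I * v))⁻¹)
        - ((√2 * √Real.pi : ℝ) : ℂ)⁻¹ *
          (Complex.exp (Complex.I * R * w) * recipGammaMain c R / phaseDeriv c w R)‖
      ≤ C * (1 + R ^ (1 / 2 - c - 1) * Real.exp (Real.pi / 2 * R)) := by
  obtain ⟨V₁, hV₁, hq⟩ := exists_phaseDeriv_bounds c
  have hA := (tendsto_norm_recipGammaMain_div c).eventually (ge_mem_nhds one_lt_two)
  obtain ⟨V₂, hA⟩ := eventually_atTop.1 hA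
  obtain ⟨C₁, hC₁, hint⟩ := exists_integral_rpow_mul_exp_le (1 / 2 - c - 1)
  -- Beyond `V` the phase bounds, the size of the main term and the Stirling error bound, which
  -- needs `8 ≤ v`, are all available.
  set V := max (max V₁ V₂) 8 with hV
  set K : ℂ := ((√2 * √Real.pi : ℝ) : ℂ)⁻¹ with hK
  have hV8 : 8 ≤ V := le_max_right _ _
  have hVV₁ : V₁ ≤ V := (le_max_left _ _).trans (le_max_left _ _)
  have hVV₂ : V₂ ≤ V := (le_max_right _ _).trans (le_max_left _ _)
  have hAb : ∀ v, V ≤ v → ‖recipGammaMain c v‖ ≤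
      2 * v * (v ^ (1 / 2 - c - 1) * Real.exp (Real.pi / 2 * v)) := by
    intro v hv
    have hv0 : 0 < v := by linarith
    have := hA v (hVV₂.trans hv)
    rw [div_le_iff₀ (by positivity)] at this
    refine this.trans_eq ?_
    rw [Real.rpow_sub_one hv0.ne']
    field_simp
  have hΓc := continuous_inv_Gamma_vertical c
  set C₀ := ∫ v in (0 : ℝ)..V, ‖(Complex.Gamma (c + Complex.I * v))⁻¹‖ with hC₀
  have hC₀0 : 0 ≤ C₀ := intervalIntegral.integral_nonneg (by linarith) fun v _ => norm_nonneg _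
  -- The summands account for the integral below `V`, the boundary term at `V`, and the two error
  -- integrals above `V`: `36 = 4 + 32`, with `4` from the integration by parts and `32` from
  -- replacing `1/Γ` by its main term.
  set C := C₀ + ‖K‖ * ‖recipGammaMain c V‖ + 36 * ‖K‖ * C₁ + 1 with hC
  have hexpn : ∀ v w : ℝ, ‖Complex.exp (Complex.I * v * w)‖ = 1 := by
    intro v w
    have : Complex.I * v * w = ((v * w : ℝ) : ℂ) * Complex.I := by push_cast; ring
    rw [this, Complex.norm_exp_ofReal_mul_I]
  refine ⟨V, C, by linarith, by positivity, fun R hR w => ?_⟩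
  have hR0 : 0 < R := by linarith
  set N := R ^ (1 / 2 - c - 1) * Real.exp (Real.pi / 2 * R) with hN
  have hN0 : 0 < N := by positivity
  have hbound : IntervalIntegrable
      (fun v : ℝ => v ^ (1 / 2 - c - 1) * Real.exp (Real.pi / 2 * v)) volume V R := by
    refine ContinuousOn.intervalIntegrable (ContinuousOn.mul
      (ContinuousOn.rpow_const continuousOn_id fun v hv => Or.inl ?_) (by fun_prop))
    rw [Set.uIcc_of_le hR] at hv
    have := hv.1
    exact (by linarith : (0 : ℝ) < v).ne'
  have hNint := hint V R (by linarith) hR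
  have hcont : Continuous fun v : ℝ =>
      Complex.exp (Complex.I * v * w) * (Complex.Gamma (c + Complex.I * v))⁻¹ :=
    Continuous.mul (by fun_prop) hΓc
  have hBc := continuous_exp_mul_recipGammaMain hc w
  have hsplit := intervalIntegral.integral_add_adjacent_intervals
    (hcont.intervalIntegrable (μ := volume) 0 V) (hcont.intervalIntegrable V R)
  have hdec : ∫ v in V..R, Complex.exp (Complex.I * v * w) * (Complex.Gamma (c + Complex.I * v))⁻¹
      = K * (∫ v in V..R, Complex.exp (Complex.I * v * w) * recipGammaMain c v)
        + ∫ v in V..R, (Complex.exp (Complex.I * v * w) * (Complex.Gamma (c + Complex.I * v))⁻¹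
          - K * (Complex.exp (Complex.I * v * w) * recipGammaMain c v)) := by
    rw [intervalIntegral.integral_sub (hcont.intervalIntegrable _ _)
      ((hBc.intervalIntegrable _ _).const_mul K), intervalIntegral.integral_const_mul]
    ring
  have hibp := integral_exp_mul_recipGammaMain hc (w := w) hR (fun v hv => by
    have := (hq v (hVV₁.trans hv.1) w).1
    exact norm_pos_iff.1 (by linarith))
  have hb0 : ‖∫ v in (0 : ℝ)..V, Complex.exp (Complex.I * v * w)
      * (Complex.Gamma (c + Complex.I * v))⁻¹‖ ≤ C₀ := by
    refine (intervalIntegral.norm_integral_le_integral_norm (by linarith)).trans_eq ?_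
    refine intervalIntegral.integral_congr fun v _ => ?_
    simp only [norm_mul, hexpn, one_mul]
  have hb1 : ‖Complex.exp (Complex.I * V * w) * recipGammaMain c V / phaseDeriv c w V‖
      ≤ ‖recipGammaMain c V‖ := by
    rw [norm_div, norm_exp_mul_recipGammaMain]
    exact div_le_self (norm_nonneg _) (hq V hVV₁ w).1
  have hb2 : ‖∫ v in V..R, Complex.exp (Complex.I * v * w) * recipGammaMain c v *
        (1 / (c + Complex.I * v) + 1 / (2 * (c + Complex.I * v) ^ 2)) / phaseDeriv c w v ^ 2‖
      ≤ 4 * (C₁ * N) := by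
    refine (intervalIntegral.norm_integral_le_of_norm_le hR (Eventually.of_forall fun v hv => ?_)
      (hbound.const_mul 4)).trans ?_
    · have hv0 : 0 < v := by linarith [hv.1]
      have h1 := hAb v hv.1.le
      have h2 := norm_deriv_phaseDeriv_le (c := c) (v := v) (by linarith [hv.1])
      rw [norm_div, norm_mul, norm_exp_mul_recipGammaMain, norm_pow]
      refine (div_le_self (by positivity) (one_le_pow₀ (hq v (hVV₁.trans hv.1.le) w).1)).trans ?_
      calc _ ≤ 2 * v * (v ^ (1 / 2 - c - 1) * Real.exp (Real.pi / 2 * v)) * (2 / v) := by gcongr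
        _ = _ := by field_simp; ring
    · rw [intervalIntegral.integral_const_mul]
      gcongr
  have hb3 : ‖∫ v in V..R, (Complex.exp (Complex.I * v * w)
        * (Complex.Gamma (c + Complex.I * v))⁻¹
        - K * (Complex.exp (Complex.I * v * w) * recipGammaMain c v))‖ ≤ 32 * ‖K‖ * (C₁ * N) := by
    refine (intervalIntegral.norm_integral_le_of_norm_le hR (Eventually.of_forall fun v hv => ?_)
      (hbound.const_mul (32 * ‖K‖))).trans ?_
    · have hv0 : 0 < v := by linarith [hv.1]
      have h1 := hAb v hv.1.le
      have h2 := norm_inv_stirlingRatio_sub_le hc (v := v) (by linarith [hv.1])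
      have e : Complex.exp (Complex.I * v * w) * (Complex.Gamma (c + Complex.I * v))⁻¹
          - K * (Complex.exp (Complex.I * v * w) * recipGammaMain c v)
          = Complex.exp (Complex.I * v * w) * recipGammaMain c v *
            ((stirlingRatio (c + Complex.I * v))⁻¹ - K) := by
        rw [inv_Gamma_eq]; ring
      rw [e, norm_mul, norm_exp_mul_recipGammaMain]
      calc _ ≤ 2 * v * (v ^ (1 / 2 - c - 1) * Real.exp (Real.pi / 2 * v)) * (16 / v * ‖K‖) := by
            gcongr
        _ = _ := by field_simp; ring
    · rw [intervalIntegral.integral_const_mul]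
      gcongr
  rw [← hsplit, hdec, hibp]
  set X₀ := ∫ v in (0 : ℝ)..V, Complex.exp (Complex.I * v * w)
      * (Complex.Gamma (c + Complex.I * v))⁻¹
  set X₁ := Complex.exp (Complex.I * V * w) * recipGammaMain c V / phaseDeriv c w V
  set X₂ := ∫ v in V..R, Complex.exp (Complex.I * v * w) * recipGammaMain c v *
        (1 / (c + Complex.I * v) + 1 / (2 * (c + Complex.I * v) ^ 2)) / phaseDeriv c w v ^ 2
  set X₃ := ∫ v in V..R, (Complex.exp (Complex.I * v * w)
        * (Complex.Gamma (c + Complex.I * v))⁻¹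
        - K * (Complex.exp (Complex.I * v * w) * recipGammaMain c v))
  set Y := Complex.exp (Complex.I * R * w) * recipGammaMain c R / phaseDeriv c w R
  have e : X₀ + (K * (Y - X₁ + X₂) + X₃) - K * Y = X₀ - K * X₁ + K * X₂ + X₃ := by ring
  rw [e]
  calc ‖X₀ - K * X₁ + K * X₂ + X₃‖ ≤ ‖X₀‖ + ‖K‖ * ‖X₁‖ + ‖K‖ * ‖X₂‖ + ‖X₃‖ := by
        refine (norm_add_le _ _).trans (add_le_add_left ((norm_add_le _ _).trans
          (add_le_add ((norm_sub_le _ _).trans_eq ?_) (norm_mul_le _ _))) _)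
        rw [norm_mul]
    _ ≤ C₀ + ‖K‖ * ‖recipGammaMain c V‖ + ‖K‖ * (4 * (C₁ * N)) + 32 * ‖K‖ * (C₁ * N) := by gcongr
    _ ≤ C * (1 + N) := by
        have h1 : 0 ≤ ‖K‖ * ‖recipGammaMain c V‖ := by positivity
        have h2 : 0 ≤ ‖K‖ * C₁ := by positivity
        have h3 : 0 ≤ (C₀ + ‖K‖ * ‖recipGammaMain c V‖ + 1) * N := by positivity
        rw [hC]
        nlinarith

section

/-! ### The truncated Fourier integral and its asymptotics -/

/-- The Fourier integral of `1 / Γ(c + iv)` over `0 ≤ v ≤ R`, at the frequency `w`. -/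
noncomputable def truncFourier (c R w : ℝ) : ℂ :=
  ∫ v in (0 : ℝ)..R, Complex.exp (Complex.I * v * w) * (Complex.Gamma (c + Complex.I * v))⁻¹

/-- The order of growth of `1 / Γ(c + iR)`. -/
noncomputable def recipGammaGrowth (c R : ℝ) : ℝ := R ^ (1 / 2 - c) * Real.exp (Real.pi / 2 * R)

/-- The leading term of `truncFourier`, normalized. -/
noncomputable def truncFourierLimit (c R w : ℝ) : ℂ :=
  Complex.I * ((√2 * √Real.pi : ℝ) : ℂ)⁻¹ *
    (Complex.exp (Complex.I * R * w) * recipGammaMain c R / recipGammaGrowth c R)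

theorem recipGammaGrowth_pos {c R : ℝ} (hR : 0 < R) : 0 < recipGammaGrowth c R := by
  unfold recipGammaGrowth; positivity

theorem tendsto_rpow_mul_exp_atTop (a : ℝ) :
    Tendsto (fun R : ℝ => R ^ a * Real.exp (Real.pi / 2 * R)) atTop atTop := by
  have := (tendsto_exp_mul_div_rpow_atTop (-a) (Real.pi / 2) (by positivity))
  refine this.congr' ?_
  filter_upwards [eventually_gt_atTop 0] with R hR
  rw [Real.rpow_neg hR.le, div_inv_eq_mul, mul_comm]

theorem norm_truncFourierLimit (c w : ℝ) {R : ℝ} (hR : 0 < R) :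
    ‖truncFourierLimit c R w‖ = ‖((√2 * √Real.pi : ℝ) : ℂ)⁻¹‖ *
      (‖recipGammaMain c R‖ / recipGammaGrowth c R) := by
  rw [truncFourierLimit, norm_mul, norm_mul, Complex.norm_I, one_mul, norm_div,
    norm_exp_mul_recipGammaMain, Complex.norm_of_nonneg (recipGammaGrowth_pos hR).le]

/-- The error is smaller than the growth of `1/Γ` by a factor `R`, while the boundary term loses
only about `log R`, so the normalized error still vanishes. The bounded part of the error is
absorbed once `R^(1/2-c-1) e^(πR/2) ≥ 1`. -/
theorem exists_norm_truncFourier_sub_le {c : ℝ} (hc : 0 < c) :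
    ∃ V₀ C : ℝ, 1 ≤ V₀ ∧ 0 < C ∧ ∀ R, V₀ ≤ R → ∀ w : ℝ,
      ‖((Real.log R / recipGammaGrowth c R : ℝ) : ℂ) * truncFourier c R w
        - ((√2 * √Real.pi : ℝ) : ℂ)⁻¹ * (Complex.exp (Complex.I * R * w) * recipGammaMain c R
          / recipGammaGrowth c R) * (Real.log R / phaseDeriv c w R)‖ ≤ C * (Real.log R / R) := by
  obtain ⟨V, C, hV, hC, h⟩ := exists_norm_integral_inv_Gamma_sub_le hc
  have h1 := (tendsto_rpow_mul_exp_atTop (1 / 2 - c - 1)).eventually_ge_atTop 1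
  obtain ⟨V', hV'⟩ := eventually_atTop.1 h1
  refine ⟨max V V', 2 * C, hV.trans (le_max_left _ _), by positivity, fun R hR w => ?_⟩
  have hRV := (le_max_left _ _).trans hR
  have hR0 : 0 < R := by linarith
  have hlog : 0 ≤ Real.log R := Real.log_nonneg (by linarith)
  have hN := recipGammaGrowth_pos (c := c) hR0
  have hb := h R hRV w
  have h1 := hV' R ((le_max_right _ _).trans hR)
  have hNR : R ^ (1 / 2 - c - 1) * Real.exp (Real.pi / 2 * R) = recipGammaGrowth c R / R := by
    rw [recipGammaGrowth, Real.rpow_sub_one hR0.ne']; ring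
  rw [hNR] at hb h1
  rw [← truncFourier] at hb
  have hNC : (recipGammaGrowth c R : ℂ) ≠ 0 := by exact_mod_cast hN.ne'
  have e : ((Real.log R / recipGammaGrowth c R : ℝ) : ℂ) * truncFourier c R w
        - ((√2 * √Real.pi : ℝ) : ℂ)⁻¹ * (Complex.exp (Complex.I * R * w) * recipGammaMain c R
          / recipGammaGrowth c R) * (Real.log R / phaseDeriv c w R)
      = ((Real.log R / recipGammaGrowth c R : ℝ) : ℂ) * (truncFourier c R w
        - ((√2 * √Real.pi : ℝ) : ℂ)⁻¹ *
          (Complex.exp (Complex.I * R * w) * recipGammaMain c R / phaseDeriv c w R)) := by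
    push_cast
    ring
  rw [e, norm_mul, Complex.norm_of_nonneg (by positivity)]
  calc Real.log R / recipGammaGrowth c R * _
      ≤ Real.log R / recipGammaGrowth c R * (C * (2 * (recipGammaGrowth c R / R))) := by
        gcongr
        refine hb.trans ?_
        gcongr
        linarith
    _ = 2 * C * (Real.log R / R) := by field_simp

theorem exists_norm_recipGammaMain_div_le (c : ℝ) :
    ∃ V₀ : ℝ, 1 ≤ V₀ ∧ ∀ R, V₀ ≤ R → ‖recipGammaMain c R‖ / recipGammaGrowth c R ≤ 2 := by
  obtain ⟨V, hV⟩ := eventually_atTop.1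
    ((tendsto_norm_recipGammaMain_div c).eventually (ge_mem_nhds one_lt_two))
  exact ⟨max V 1, le_max_right _ _, fun R hR => hV R ((le_max_left _ _).trans hR)⟩

/-- A bound for the normalized `truncFourier` that is uniform in the length of the interval. -/
theorem exists_norm_truncFourier_le {c : ℝ} (hc : 0 < c) :
    ∃ V₀ C : ℝ, 1 ≤ V₀ ∧ 0 < C ∧ ∀ R, V₀ ≤ R → ∀ w : ℝ,
      ‖((Real.log R / recipGammaGrowth c R : ℝ) : ℂ) * truncFourier c R w‖ ≤ C * (1 + |w|) ∧
      ‖truncFourierLimit c R w‖ ≤ C * (1 + |w|) := by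
  obtain ⟨V₁, C, hV₁, hC, h⟩ := exists_norm_truncFourier_sub_le hc
  obtain ⟨V₂, hV₂, hA⟩ := exists_norm_recipGammaMain_div_le c
  obtain ⟨V₃, hV₃, hq⟩ := exists_phaseDeriv_bounds c
  set K := ‖((√2 * √Real.pi : ℝ) : ℂ)⁻¹‖ with hK
  have hK0 : 0 ≤ K := norm_nonneg _
  refine ⟨max (max V₁ V₂) V₃, C + K * 4, by simp [hV₃], by positivity, fun R hR w => ?_⟩
  have hR1 := ((le_max_left _ _).trans (le_max_left _ _)).trans hR
  have hR2 := ((le_max_right _ _).trans (le_max_left _ _)).trans hR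
  have hR3 := (le_max_right _ _).trans hR
  have hR0 : 0 < R := by linarith
  have hb := h R hR1 w
  have hAb := hA R hR2
  have hN := recipGammaGrowth_pos (c := c) hR0
  obtain ⟨hq1, hq2⟩ := hq R hR3 w
  have hlog : 0 ≤ Real.log R := Real.log_nonneg (by linarith)
  have hlogR : Real.log R / R ≤ 1 := by
    rw [div_le_one hR0]
    linarith [Real.log_le_sub_one_of_pos hR0]
  have hw := abs_nonneg w
  constructor
  · have h3 : ‖((√2 * √Real.pi : ℝ) : ℂ)⁻¹ * (Complex.exp (Complex.I * R * w) * recipGammaMain c R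
          / recipGammaGrowth c R) * (Real.log R / phaseDeriv c w R)‖ ≤ K * 2 * (2 * (1 + |w|)) := by
      rw [norm_mul, norm_mul, norm_div, norm_exp_mul_recipGammaMain, Complex.norm_of_nonneg hN.le,
        norm_div, Complex.norm_of_nonneg hlog]
      gcongr
      rw [div_le_iff₀ (by linarith)]
      nlinarith
    have h4 : C * (Real.log R / R) ≤ C * 1 := by gcongr
    have := norm_le_norm_add_norm_sub' (((Real.log R / recipGammaGrowth c R : ℝ) : ℂ)
      * truncFourier c R w) (((√2 * √Real.pi : ℝ) : ℂ)⁻¹ * (Complex.exp (Complex.I * R * w)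
        * recipGammaMain c R / recipGammaGrowth c R) * (Real.log R / phaseDeriv c w R))
    nlinarith [mul_nonneg hC.le hw]
  · rw [norm_truncFourierLimit c w hR0]
    calc K * (‖recipGammaMain c R‖ / recipGammaGrowth c R) ≤ K * 2 := by gcongr
      _ ≤ _ := by nlinarith [mul_nonneg hC.le hw, mul_nonneg hK0 hw]

theorem tendsto_truncFourier_sub {c : ℝ} (hc : 0 < c) (w : ℝ) :
    Tendsto (fun R => ((Real.log R / recipGammaGrowth c R : ℝ) : ℂ) * truncFourier c R w
      - truncFourierLimit c R w) atTop (𝓝 0) := by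
  obtain ⟨V₁, C, hV₁, hC, h⟩ := exists_norm_truncFourier_sub_le hc
  obtain ⟨V₂, hV₂, hA⟩ := exists_norm_recipGammaMain_div_le c
  set K : ℂ := ((√2 * √Real.pi : ℝ) : ℂ)⁻¹ with hK
  have hlog : Tendsto (fun R : ℝ => C * (Real.log R / R)) atTop (𝓝 0) := by
    have := Real.isLittleO_log_id_atTop.tendsto_div_nhds_zero
    simpa using this.const_mul C
  have hq : Tendsto (fun R : ℝ => ‖K‖ * 2 * ‖(Real.log R : ℂ) / phaseDeriv c w R - Complex.I‖)
      atTop (𝓝 0) := by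
    have := (tendsto_log_div_phaseDeriv c w).sub_const Complex.I
    rw [sub_self] at this
    simpa using (this.norm).const_mul (‖K‖ * 2)
  have hsum := hlog.add hq
  rw [add_zero] at hsum
  refine squeeze_zero_norm' ?_ hsum
  filter_upwards [eventually_ge_atTop (max V₁ V₂)] with R hR
  have hR1 := (le_max_left _ _).trans hR
  have hR2 := (le_max_right _ _).trans hR
  have hR0 : 0 < R := by linarith
  have hN := recipGammaGrowth_pos (c := c) hR0
  have e : ((Real.log R / recipGammaGrowth c R : ℝ) : ℂ) * truncFourier c R w
      - truncFourierLimit c R w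
      = (((Real.log R / recipGammaGrowth c R : ℝ) : ℂ) * truncFourier c R w
        - K * (Complex.exp (Complex.I * R * w) * recipGammaMain c R
          / recipGammaGrowth c R) * (Real.log R / phaseDeriv c w R))
        + K * (Complex.exp (Complex.I * R * w) * recipGammaMain c R
          / recipGammaGrowth c R) * (Real.log R / phaseDeriv c w R - Complex.I) := by
    rw [truncFourierLimit]
    ring
  rw [e]
  refine (norm_add_le _ _).trans (add_le_add (h R hR1 w) ?_)
  rw [norm_mul, norm_mul, norm_div, norm_exp_mul_recipGammaMain, Complex.norm_of_nonneg hN.le]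
  gcongr
  exact hA R hR2

theorem continuous_truncFourier (c R : ℝ) : Continuous (truncFourier c R) := by
  unfold truncFourier
  refine intervalIntegral.continuous_parametric_intervalIntegral_of_continuous' ?_ _ _
  refine Continuous.mul (by fun_prop) ?_
  exact (continuous_inv_Gamma_vertical c).comp continuous_snd

/-! ### The first two moments of the leading term -/

variable {μ : Measure ℝ} {κ s : ℝ}

/-- The oscillation in `log y²` is a complex power `|y|^(2iR)` up to the constant `κ^(-iR)`, so
integrals against it are moments on a vertical line. -/
theorem rpow_mul_exp_log_eq {y : ℝ} (hy : y ≠ 0) (hκ : 0 < κ) (s R : ℝ) :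
    ((|y| ^ s : ℝ) : ℂ) * Complex.exp (Complex.I * R * Real.log (y ^ 2 / κ)) =
      Complex.exp (-(Complex.I * R * Real.log κ)) *
        ((|y| : ℝ) : ℂ) ^ (s + (2 * R : ℝ) * Complex.I : ℂ) := by
  have hy' : 0 < |y| := abs_pos.2 hy
  have hyC : ((|y| : ℝ) : ℂ) ≠ 0 := by exact_mod_cast hy'.ne'
  rw [Complex.cpow_def_of_ne_zero hyC, Real.rpow_def_of_pos hy', Real.log_div (pow_ne_zero 2 hy)
    hκ.ne', ← sq_abs, Real.log_pow, Complex.ofReal_exp, ← Complex.exp_add, ← Complex.exp_add,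
    ← Complex.ofReal_log hy'.le]
  congr 1
  push_cast
  ring

theorem tendsto_integral_rpow_mul_exp (hne : ∀ᵐ y ∂μ, y ≠ 0) (hκ : 0 < κ)
    (hRL : Tendsto (fun u : ℝ => ∫ y : ℝ, ((|y| : ℝ) : ℂ) ^ (s + u * Complex.I : ℂ) ∂μ)
      atTop (𝓝 0)) :
    Tendsto (fun R : ℝ => ∫ y : ℝ, ((|y| ^ s : ℝ) : ℂ)
      * Complex.exp (Complex.I * R * Real.log (y ^ 2 / κ)) ∂μ) atTop (𝓝 0) := by
  rw [tendsto_zero_iff_norm_tendsto_zero] at hRL ⊢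
  refine (hRL.comp (tendsto_id.const_mul_atTop two_pos)).congr fun R => ?_
  have : ∫ y : ℝ, ((|y| ^ s : ℝ) : ℂ) * Complex.exp (Complex.I * R * Real.log (y ^ 2 / κ)) ∂μ
      = ∫ y : ℝ, Complex.exp (-(Complex.I * R * Real.log κ)) *
        ((|y| : ℝ) : ℂ) ^ (s + (2 * R : ℝ) * Complex.I : ℂ) ∂μ :=
    integral_congr_ae (by filter_upwards [hne] with y hy using rpow_mul_exp_log_eq hy hκ s R)
  rw [this, integral_const_mul, norm_mul]
  have e : -(Complex.I * R * Real.log κ) = ((-(R * Real.log κ) : ℝ) : ℂ) * Complex.I := by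
    push_cast; ring
  rw [e, Complex.norm_exp_ofReal_mul_I, one_mul]
  rfl

end

section

/-! ### The normalized kernel of the estimator -/

variable {μ : Measure ℝ} {c κ s : ℝ}

/-- The normalized kernel of the estimator. -/
noncomputable def normalizedKernel (c κ s R y : ℝ) : ℝ :=
  |y| ^ s * (((Real.log R / recipGammaGrowth c R : ℝ) : ℂ)
    * truncFourier c R (Real.log (y ^ 2 / κ))).re

/-- The oscillating leading term of `normalizedKernel`. -/
noncomputable def limitKernel (c κ s R y : ℝ) : ℝ :=
  |y| ^ s * (truncFourierLimit c R (Real.log (y ^ 2 / κ))).re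

theorem measurable_truncFourier_log (c κ R : ℝ) :
    Measurable fun y : ℝ => truncFourier c R (Real.log (y ^ 2 / κ)) :=
  (continuous_truncFourier c R).measurable.comp (by fun_prop)

theorem measurable_normalizedKernel (c κ s R : ℝ) : Measurable (normalizedKernel c κ s R) := by
  have := measurable_truncFourier_log c κ R
  unfold normalizedKernel
  fun_prop

theorem measurable_limitKernel (c κ s R : ℝ) : Measurable (limitKernel c κ s R) := by
  unfold limitKernel truncFourierLimit
  fun_prop

/-- The product of a power and a logarithm that dominates the normalized kernels. -/
noncomputable def kernelBound (κ s y : ℝ) : ℝ := (1 + |Real.log (y ^ 2 / κ)|) * |y| ^ s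

theorem measurable_kernelBound (κ s : ℝ) : Measurable (kernelBound κ s) := by
  unfold kernelBound
  fun_prop

theorem rpow_le_kernelBound (κ s y : ℝ) : |y| ^ s ≤ kernelBound κ s y :=
  le_mul_of_one_le_left (by positivity) (by linarith [abs_nonneg (Real.log (y ^ 2 / κ))])

theorem exists_abs_kernel_le (hc : 0 < c) (κ s : ℝ) :
    ∃ C : ℝ, 0 < C ∧ ∀ᶠ R in atTop, ∀ y,
      |normalizedKernel c κ s R y| ≤ C * kernelBound κ s y ∧
      |limitKernel c κ s R y| ≤ C * kernelBound κ s y := by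
  obtain ⟨V, C, hV, hC, h⟩ := exists_norm_truncFourier_le hc
  refine ⟨C, hC, eventually_atTop.2 ⟨V, fun R hR y => ?_⟩⟩
  obtain ⟨h1, h2⟩ := h R hR (Real.log (y ^ 2 / κ))
  have hy : 0 ≤ |y| ^ s := by positivity
  rw [normalizedKernel, limitKernel, abs_mul, abs_mul, abs_of_nonneg hy, kernelBound]
  constructor
  · calc _ ≤ |y| ^ s * (C * (1 + |Real.log (y ^ 2 / κ)|)) := by
          gcongr; exact (Complex.abs_re_le_norm _).trans h1
      _ = _ := by ring
  · calc _ ≤ |y| ^ s * (C * (1 + |Real.log (y ^ 2 / κ)|)) := by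
          gcongr; exact (Complex.abs_re_le_norm _).trans h2
      _ = _ := by ring

theorem tendsto_normalizedKernel_sub (hc : 0 < c) (κ s y : ℝ) :
    Tendsto (fun R => normalizedKernel c κ s R y - limitKernel c κ s R y) atTop (𝓝 0) := by
  have h := (Complex.continuous_re.tendsto 0).comp
    (tendsto_truncFourier_sub hc (Real.log (y ^ 2 / κ)))
  have := h.const_mul (|y| ^ s)
  simp only [Complex.zero_re, mul_zero] at this
  refine this.congr fun R => ?_
  simp only [Function.comp, Complex.sub_re, normalizedKernel, limitKernel]
  ring

theorem integrable_kernelBound [IsProbabilityMeasure μ] (hD : Integrable (fun y => kernelBound κ s y ^ 2) μ) :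
    Integrable (kernelBound κ s) μ :=
  ((memLp_two_iff_integrable_sq (measurable_kernelBound κ s).aestronglyMeasurable).2 hD).integrable
    (by norm_num)

theorem integrable_of_abs_le_kernelBound [IsProbabilityMeasure μ]
    (hD : Integrable (fun y => kernelBound κ s y ^ 2) μ)
    {f : ℝ → ℝ} (hf : Measurable f) {C : ℝ} (h : ∀ y, |f y| ≤ C * kernelBound κ s y) :
    Integrable f μ :=
  ((integrable_kernelBound hD).const_mul C).mono' hf.aestronglyMeasurable (Eventually.of_forall h)

theorem integrable_sq_of_abs_le_kernelBound (hD : Integrable (fun y => kernelBound κ s y ^ 2) μ)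
    {f : ℝ → ℝ} (hf : Measurable f) {C : ℝ} (h : ∀ y, |f y| ≤ C * kernelBound κ s y) :
    Integrable (fun y => f y ^ 2) μ := by
  refine (hD.const_mul (C ^ 2)).mono' (hf.pow_const 2).aestronglyMeasurable
    (Eventually.of_forall fun y => ?_)
  rw [Real.norm_eq_abs, abs_pow, ← mul_pow]
  exact pow_le_pow_left₀ (abs_nonneg _) (h y) 2

theorem integrable_rpow_of_kernelBound [IsProbabilityMeasure μ]
    (hD : Integrable (fun y => kernelBound κ s y ^ 2) μ) :
    Integrable (fun y : ℝ => |y| ^ s) μ :=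
  integrable_of_abs_le_kernelBound hD (by fun_prop) (C := 1) fun y => by
    rw [abs_of_nonneg (by positivity), one_mul]; exact rpow_le_kernelBound κ s y

theorem rpow_sq_eq (s y : ℝ) : (|y| ^ s) ^ 2 = |y| ^ (s * 2) := by
  rw [← Real.rpow_natCast, ← Real.rpow_mul (abs_nonneg y)]
  norm_num

theorem integrable_rpow_two_mul_of_kernelBound
    (hD : Integrable (fun y => kernelBound κ s y ^ 2) μ) :
    Integrable (fun y : ℝ => |y| ^ (s * 2)) μ := by
  simp only [← rpow_sq_eq]
  exact integrable_sq_of_abs_le_kernelBound hD (by fun_prop) (C := 1) fun y => by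
    rw [abs_of_nonneg (by positivity), one_mul]; exact rpow_le_kernelBound κ s y

theorem integrable_rpow_mul_exp {a : ℝ} (h : Integrable (fun y : ℝ => |y| ^ a) μ) (R : ℝ) :
    Integrable (fun y : ℝ => ((|y| ^ a : ℝ) : ℂ)
      * Complex.exp (Complex.I * R * Real.log (y ^ 2 / κ))) μ := by
  refine h.mono' (Measurable.aestronglyMeasurable (by fun_prop)) (Eventually.of_forall fun y => ?_)
  have e : Complex.I * R * Real.log (y ^ 2 / κ) = ((R * Real.log (y ^ 2 / κ) : ℝ) : ℂ) * Complex.I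
    := by push_cast; ring
  rw [norm_mul, e, Complex.norm_exp_ofReal_mul_I, mul_one, Complex.norm_of_nonneg (by positivity)]

/-- The amplitude of `truncFourierLimit`. -/
noncomputable def limitAmplitude (c R : ℝ) : ℂ :=
  Complex.I * ((√2 * √Real.pi : ℝ) : ℂ)⁻¹ * (recipGammaMain c R / recipGammaGrowth c R)

theorem truncFourierLimit_eq (c R w : ℝ) :
    truncFourierLimit c R w = limitAmplitude c R * Complex.exp (Complex.I * R * w) := by
  rw [truncFourierLimit, limitAmplitude]; ring

theorem tendsto_norm_limitAmplitude (c : ℝ) :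
    Tendsto (fun R => ‖limitAmplitude c R‖) atTop (𝓝 ‖((√2 * √Real.pi : ℝ) : ℂ)⁻¹‖) := by
  have := (tendsto_norm_recipGammaMain_div c).const_mul ‖((√2 * √Real.pi : ℝ) : ℂ)⁻¹‖
  rw [mul_one] at this
  refine this.congr' ?_
  filter_upwards [eventually_gt_atTop 0] with R hR
  rw [limitAmplitude, norm_mul, norm_mul, Complex.norm_I, one_mul, norm_div,
    Complex.norm_of_nonneg (recipGammaGrowth_pos hR).le, recipGammaGrowth]

/-- Dominated convergence replaces the kernel by its oscillating leading term, whose mean is a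
bounded amplitude times a vanishing vertical moment. -/
theorem tendsto_integral_normalizedKernel [IsProbabilityMeasure μ] (hc : 0 < c) (hκ : 0 < κ)
    (hne : ∀ᵐ y ∂μ, y ≠ 0)
    (hD : Integrable (fun y => kernelBound κ s y ^ 2) μ)
    (hRL : Tendsto (fun u : ℝ => ∫ y : ℝ, ((|y| : ℝ) : ℂ) ^ (s + u * Complex.I : ℂ) ∂μ)
      atTop (𝓝 0)) :
    Tendsto (fun R => ∫ y, normalizedKernel c κ s R y ∂μ) atTop (𝓝 0) := by
  obtain ⟨C, hC, hbound⟩ := exists_abs_kernel_le hc κ s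
  have hdiff : Tendsto (fun R => ∫ y, (normalizedKernel c κ s R y - limitKernel c κ s R y) ∂μ)
      atTop (𝓝 0) := by
    rw [← integral_zero ℝ ℝ (μ := μ)]
    refine tendsto_integral_filter_of_dominated_convergence (fun y => 2 * C * kernelBound κ s y)
      (Eventually.of_forall fun R => ((measurable_normalizedKernel c κ s R).sub
        (measurable_limitKernel c κ s R)).aestronglyMeasurable) ?_
      ((integrable_kernelBound hD).const_mul _)
      (Eventually.of_forall fun y => tendsto_normalizedKernel_sub hc κ s y)
    filter_upwards [hbound] with R hR
    refine Eventually.of_forall fun y => (norm_sub_le _ _).trans ?_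
    rw [Real.norm_eq_abs, Real.norm_eq_abs]
    linarith [(hR y).1, (hR y).2]
  have hmain : Tendsto (fun R => ∫ y, limitKernel c κ s R y ∂μ) atTop (𝓝 0) := by
    have h1 : Tendsto (fun R : ℝ => limitAmplitude c R * ∫ y : ℝ, ((|y| ^ s : ℝ) : ℂ)
        * Complex.exp (Complex.I * R * Real.log (y ^ 2 / κ)) ∂μ) atTop (𝓝 0) := by
      have := isBoundedUnder_le_mul_tendsto_zero
        (tendsto_norm_limitAmplitude c).isBoundedUnder_le
        (tendsto_integral_rpow_mul_exp hne hκ hRL)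
      exact this
    have h2 := (Complex.continuous_re.tendsto 0).comp h1
    rw [Complex.zero_re] at h2
    refine h2.congr fun R => ?_
    rw [Function.comp, ← integral_const_mul]
    have := integral_re (((integrable_rpow_mul_exp (κ := κ)
      (integrable_rpow_of_kernelBound hD) R)).const_mul (limitAmplitude c R))
    refine Eq.trans this.symm (integral_congr_ae (Eventually.of_forall fun y => ?_))
    simp only [limitKernel, truncFourierLimit_eq]
    rw [← Complex.re_ofReal_mul]
    change (_ : ℂ).re = _
    congr 1
    ring
  have := hdiff.add hmain
  rw [add_zero] at this
  refine this.congr' ?_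
  filter_upwards [hbound] with R hR
  rw [← integral_add]
  · simp
  · exact (integrable_of_abs_le_kernelBound hD (measurable_normalizedKernel c κ s R)
      fun y => (hR y).1).sub (integrable_of_abs_le_kernelBound hD (measurable_limitKernel c κ s R)
      fun y => (hR y).2)
  · exact integrable_of_abs_le_kernelBound hD (measurable_limitKernel c κ s R) fun y => (hR y).2

/-- From `(Re Z)² = |Z|²/2 + Re(Z²)/2`: the first part does not oscillate, the second oscillates at
the doubled frequency. -/
theorem limitKernel_sq (c κ s R y : ℝ) :
    limitKernel c κ s R y ^ 2 = 1 / 2 * ‖limitAmplitude c R‖ ^ 2 * |y| ^ (s * 2) +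
      1 / 2 * (limitAmplitude c R ^ 2 * (((|y| ^ (s * 2) : ℝ) : ℂ)
        * Complex.exp (Complex.I * (2 * R : ℝ) * Real.log (y ^ 2 / κ)))).re := by
  rw [limitKernel, mul_pow, rpow_sq_eq]
  set Z := truncFourierLimit c R (Real.log (y ^ 2 / κ)) with hZ
  have hn : ‖Z‖ = ‖limitAmplitude c R‖ := by
    have e : Complex.I * R * Real.log (y ^ 2 / κ)
      = ((R * Real.log (y ^ 2 / κ) : ℝ) : ℂ) * Complex.I := by push_cast; ring
    rw [hZ, truncFourierLimit_eq, norm_mul, e, Complex.norm_exp_ofReal_mul_I, mul_one]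
  have h2 : limitAmplitude c R ^ 2 * (((|y| ^ (s * 2) : ℝ) : ℂ)
        * Complex.exp (Complex.I * (2 * R : ℝ) * Real.log (y ^ 2 / κ)))
      = ((|y| ^ (s * 2) : ℝ) : ℂ) * Z ^ 2 := by
    rw [hZ, truncFourierLimit_eq, mul_pow, ← Complex.exp_nat_mul]
    push_cast
    ring_nf
  rw [h2, ← hn, Complex.re_ofReal_mul, ← Complex.normSq_eq_norm_sq, Complex.normSq_apply, sq Z,
    Complex.mul_re]
  ring

/-- The limit is the mean of the non-oscillating half of the squared leading term; the phase of the
amplitude plays no role, which is why a limit exists although the kernels do not converge. -/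
theorem tendsto_integral_normalizedKernel_sq (hc : 0 < c) (hκ : 0 < κ) (hne : ∀ᵐ y ∂μ, y ≠ 0)
    (hD : Integrable (fun y => kernelBound κ s y ^ 2) μ)
    (hRL : Tendsto (fun u : ℝ => ∫ y : ℝ, ((|y| : ℝ) : ℂ) ^ ((s * 2 : ℝ) + u * Complex.I : ℂ) ∂μ)
      atTop (𝓝 0)) :
    Tendsto (fun R => ∫ y, normalizedKernel c κ s R y ^ 2 ∂μ) atTop
      (𝓝 (1 / 2 * ‖((√2 * √Real.pi : ℝ) : ℂ)⁻¹‖ ^ 2 * ∫ y : ℝ, |y| ^ (s * 2) ∂μ)) := by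
  obtain ⟨C, hC, hbound⟩ := exists_abs_kernel_le hc κ s
  have hdiff : Tendsto (fun R => ∫ y, (normalizedKernel c κ s R y ^ 2
      - limitKernel c κ s R y ^ 2) ∂μ) atTop (𝓝 0) := by
    rw [← integral_zero ℝ ℝ (μ := μ)]
    refine tendsto_integral_filter_of_dominated_convergence
      (fun y => 2 * C ^ 2 * kernelBound κ s y ^ 2)
      (Eventually.of_forall fun R => (((measurable_normalizedKernel c κ s R).pow_const 2).sub
        ((measurable_limitKernel c κ s R).pow_const 2)).aestronglyMeasurable) ?_
      (hD.const_mul _) (Eventually.of_forall fun y => ?_)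
    · filter_upwards [hbound] with R hR
      refine Eventually.of_forall fun y => (norm_sub_le _ _).trans ?_
      rw [norm_pow, norm_pow, Real.norm_eq_abs, Real.norm_eq_abs]
      have h1 := pow_le_pow_left₀ (abs_nonneg _) (hR y).1 2
      have h2 := pow_le_pow_left₀ (abs_nonneg _) (hR y).2 2
      rw [mul_pow] at h1 h2
      linarith
    · have h1 := tendsto_normalizedKernel_sub hc κ s y
      -- The difference of squares is the vanishing difference times the sum, which is bounded for
      -- fixed `y`.
      have h2 : IsBoundedUnder (· ≤ ·) atTop
          (fun R => ‖normalizedKernel c κ s R y + limitKernel c κ s R y‖) := by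
        refine ⟨2 * (C * kernelBound κ s y), eventually_map.2 ?_⟩
        filter_upwards [hbound] with R hR
        refine (norm_add_le _ _).trans ?_
        rw [Real.norm_eq_abs, Real.norm_eq_abs]
        linarith [(hR y).1, (hR y).2]
      refine (isBoundedUnder_le_mul_tendsto_zero h2 h1).congr fun R => ?_
      simp only [sq]
      ring
  have hg := integrable_rpow_two_mul_of_kernelBound hD
  have hmain : Tendsto (fun R => ∫ y, limitKernel c κ s R y ^ 2 ∂μ) atTop
      (𝓝 (1 / 2 * ‖((√2 * √Real.pi : ℝ) : ℂ)⁻¹‖ ^ 2 * ∫ y : ℝ, |y| ^ (s * 2) ∂μ)) := by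
    have h1 : Tendsto (fun R : ℝ => limitAmplitude c R ^ 2 * ∫ y : ℝ, ((|y| ^ (s * 2) : ℝ) : ℂ)
        * Complex.exp (Complex.I * (2 * R : ℝ) * Real.log (y ^ 2 / κ)) ∂μ) atTop (𝓝 0) := by
      have hb : IsBoundedUnder (· ≤ ·) atTop (fun R => ‖limitAmplitude c R ^ 2‖) := by
        simp only [norm_pow]
        exact ((tendsto_norm_limitAmplitude c).pow 2).isBoundedUnder_le
      exact isBoundedUnder_le_mul_tendsto_zero hb
        ((tendsto_integral_rpow_mul_exp hne hκ hRL).comp (tendsto_id.const_mul_atTop two_pos))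
    have h2 := ((Complex.continuous_re.tendsto 0).comp h1).const_mul (1 / 2)
    rw [Complex.zero_re, mul_zero] at h2
    have h3 := ((((tendsto_norm_limitAmplitude c).pow 2).const_mul (1 / 2)).mul_const
      (∫ y : ℝ, |y| ^ (s * 2) ∂μ)).add h2
    rw [add_zero] at h3
    refine h3.congr fun R => ?_
    have hi := (integrable_rpow_mul_exp (κ := κ) hg (2 * R)).const_mul (limitAmplitude c R ^ 2)
    have hi' : Integrable (fun y : ℝ => (limitAmplitude c R ^ 2 * (((|y| ^ (s * 2) : ℝ) : ℂ)
        * Complex.exp (Complex.I * (2 * R : ℝ) * Real.log (y ^ 2 / κ)))).re) μ := hi.re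
    have hre : ∫ y : ℝ, (limitAmplitude c R ^ 2 * (((|y| ^ (s * 2) : ℝ) : ℂ)
        * Complex.exp (Complex.I * (2 * R : ℝ) * Real.log (y ^ 2 / κ)))).re ∂μ
        = (∫ y : ℝ, limitAmplitude c R ^ 2 * (((|y| ^ (s * 2) : ℝ) : ℂ)
        * Complex.exp (Complex.I * (2 * R : ℝ) * Real.log (y ^ 2 / κ))) ∂μ).re := integral_re hi
    simp only [limitKernel_sq]
    rw [integral_add (hg.const_mul _) (hi'.const_mul _), integral_const_mul, integral_const_mul,
      hre, Function.comp, integral_const_mul (limitAmplitude c R ^ 2)]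
  have := hdiff.add hmain
  rw [zero_add] at this
  refine this.congr' ?_
  filter_upwards [hbound] with R hR
  rw [← integral_add]
  · simp
  · exact (integrable_sq_of_abs_le_kernelBound hD (measurable_normalizedKernel c κ s R)
      fun y => (hR y).1).sub (integrable_sq_of_abs_le_kernelBound hD
      (measurable_limitKernel c κ s R) fun y => (hR y).2)
  · exact integrable_sq_of_abs_le_kernelBound hD (measurable_limitKernel c κ s R) fun y => (hR y).2

end

/-! ### The estimator as an empirical mean -/

/-- The contribution of the observation `y` to the estimator with bandwidth `1 / R`. -/
noncomputable def estimatorKernel (γ x R y : ℝ) : ℝ :=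
  2 * (2 * x) ^ (-γ) / √Real.pi * (|y| ^ (2 * γ - 2)
    * (truncFourier (γ - 1 / 2) R (Real.log (y ^ 2 / (2 * x)))).re)

/-- All dependence on `v` in the three powers collects into the single frequency `log (y²/(2x))`. -/
theorem estimator_integrand_eq {x y γ : ℝ} (hx : 0 < x) (hy : y ≠ 0) (v : ℝ) :
    (x : ℂ) ^ (-(γ : ℂ) - Complex.I * v) * (((|y| : ℝ) : ℂ) ^ (2 * ((γ : ℂ) + Complex.I * v) - 1 - 1)
      / ((2 : ℂ) ^ ((γ : ℂ) + Complex.I * v) * Complex.Gamma ((γ : ℂ) - 1 / 2 + Complex.I * v)))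
    = (((2 * x) ^ (-γ) * |y| ^ (2 * γ - 2) : ℝ) : ℂ)
      * (Complex.exp (Complex.I * v * Real.log (y ^ 2 / (2 * x)))
        * (Complex.Gamma ((γ - 1 / 2 : ℝ) + Complex.I * v))⁻¹) := by
  have hy' : 0 < |y| := abs_pos.2 hy
  have hyC : ((|y| : ℝ) : ℂ) ≠ 0 := by exact_mod_cast hy'.ne'
  have hxC : (x : ℂ) ≠ 0 := by exact_mod_cast hx.ne'
  have hΓ : ((γ : ℂ) - 1 / 2 + Complex.I * v) = ((γ - 1 / 2 : ℝ) + Complex.I * v) := by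
    push_cast; ring
  have h2 : Complex.log 2 = ((Real.log 2 : ℝ) : ℂ) := by
    rw [Complex.ofReal_log two_pos.le]; norm_num
  have key : (x : ℂ) ^ (-(γ : ℂ) - Complex.I * v)
      * ((|y| : ℝ) : ℂ) ^ (2 * ((γ : ℂ) + Complex.I * v) - 1 - 1)
      * ((2 : ℂ) ^ ((γ : ℂ) + Complex.I * v))⁻¹
      = (((2 * x) ^ (-γ) * |y| ^ (2 * γ - 2) : ℝ) : ℂ)
      * Complex.exp (Complex.I * v * Real.log (y ^ 2 / (2 * x))) := by
    rw [Complex.cpow_def_of_ne_zero hxC, Complex.cpow_def_of_ne_zero hyC,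
      Complex.cpow_def_of_ne_zero two_ne_zero, Real.rpow_def_of_pos (by positivity),
      Real.rpow_def_of_pos hy', Real.log_div (pow_ne_zero 2 hy) (by positivity), ← sq_abs y,
      Real.log_pow, Real.log_mul two_ne_zero hx.ne', ← Real.exp_add, Complex.ofReal_exp,
      ← Complex.exp_neg, ← Complex.exp_add, ← Complex.exp_add, ← Complex.exp_add, h2,
      ← Complex.ofReal_log hx.le, ← Complex.ofReal_log hy'.le]
    congr 1
    push_cast
    ring
  rw [hΓ, ← mul_assoc (((2 * x) ^ (-γ) * |y| ^ (2 * γ - 2) : ℝ) : ℂ), ← key]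
  rw [div_eq_mul_inv, mul_inv]
  ring

/-- The integrand at `-v` is the conjugate of the integrand at `v`, so the two half-intervals
contribute conjugate values. -/
theorem re_integral_symm_eq (c w R : ℝ) :
    (∫ v in (-R)..R, Complex.exp (Complex.I * v * w)
      * (Complex.Gamma (c + Complex.I * v))⁻¹).re = 2 * (truncFourier c R w).re := by
  have hcont : Continuous fun v : ℝ =>
      Complex.exp (Complex.I * v * w) * (Complex.Gamma (c + Complex.I * v))⁻¹ :=
    Continuous.mul (by fun_prop) (continuous_inv_Gamma_vertical c)
  have h1 : ∫ v in (-R)..0, Complex.exp (Complex.I * v * w)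
      * (Complex.Gamma (c + Complex.I * v))⁻¹ = (starRingEnd ℂ) (truncFourier c R w) := by
    rw [truncFourier, ← intervalIntegral.intervalIntegral_conj, ← neg_zero,
      ← intervalIntegral.integral_comp_neg, neg_zero]
    refine intervalIntegral.integral_congr fun v _ => ?_
    simp only [map_mul, map_inv₀, ← Complex.Gamma_conj, ← Complex.exp_conj, map_add,
      Complex.conj_ofReal, Complex.conj_I, Complex.ofReal_neg, mul_neg, neg_mul]
  rw [← intervalIntegral.integral_add_adjacent_intervals (hcont.intervalIntegrable (-R) 0)
    (hcont.intervalIntegrable 0 R), h1, ← truncFourier, Complex.add_re, Complex.conj_re]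
  ring

theorem boxKernel_eq_indicator {h : ℝ} (hh : 0 < h) (v : ℝ) :
    boxKernel (v * h) = (Set.Icc (-(1 / h)) (1 / h)).indicator (fun _ => 1) v := by
  unfold boxKernel Set.indicator
  have : v * h ∈ Set.Icc (-1 : ℝ) 1 ↔ v ∈ Set.Icc (-(1 / h)) (1 / h) := by
    simp only [Set.mem_Icc]
    rw [le_div_iff₀ hh, ← neg_div, div_le_iff₀ hh]
  simp only [this]

theorem estimator_eq_sum {X : ℕ → ℝ} (hX : ∀ k, X k ≠ 0) (n : ℕ) {h γ x : ℝ} (hh : 0 < h)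
    (hx : 0 < x) :
    estimator X n h γ x = (n : ℝ)⁻¹ * ∑ k ∈ Finset.range n, estimatorKernel γ x (1 / h) (X k) := by
  set R := 1 / h with hR
  have hR0 : 0 < R := by positivity
  set f : ℕ → ℝ → ℂ := fun k v => (((2 * x) ^ (-γ) * |X k| ^ (2 * γ - 2) : ℝ) : ℂ)
      * (Complex.exp (Complex.I * v * Real.log (X k ^ 2 / (2 * x)))
        * (Complex.Gamma ((γ - 1 / 2 : ℝ) + Complex.I * v))⁻¹) with hf
  have hcont : ∀ k, Continuous (f k) := fun k => continuous_const.mul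
    (Continuous.mul (by fun_prop) (continuous_inv_Gamma_vertical _))
  have hpt : ∀ v : ℝ, (x : ℂ) ^ (-(γ : ℂ) - Complex.I * v) * (boxKernel (v * h) : ℂ)
      * (empiricalMellin X n (2 * ((γ : ℂ) + Complex.I * v) - 1)
        / ((2 : ℂ) ^ ((γ : ℂ) + Complex.I * v)
            * Complex.Gamma ((γ : ℂ) - 1 / 2 + Complex.I * v)))
      = (Set.Icc (-R) R).indicator (fun v => (n : ℂ)⁻¹ * ∑ k ∈ Finset.range n, f k v) v := by
    intro v
    rw [boxKernel_eq_indicator hh]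
    by_cases hv : v ∈ Set.Icc (-R) R
    · rw [Set.indicator_of_mem hv, Set.indicator_of_mem hv, empiricalMellin, Complex.ofReal_one,
        mul_one, mul_div_assoc, ← mul_assoc, mul_comm _ ((n : ℂ)⁻¹), mul_assoc, Finset.sum_div,
        Finset.mul_sum]
      congr 1
      refine Finset.sum_congr rfl fun k _ => ?_
      exact estimator_integrand_eq hx (hX k) v
    · rw [Set.indicator_of_notMem hv, Set.indicator_of_notMem hv, Complex.ofReal_zero, mul_zero,
        zero_mul]
  rw [estimator, estimatorC, Complex.re_ofReal_mul]
  simp only [hpt]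
  rw [integral_indicator measurableSet_Icc, integral_Icc_eq_integral_Ioc,
    ← intervalIntegral.integral_of_le (by linarith), intervalIntegral.integral_const_mul,
    intervalIntegral.integral_finsetSum fun k _ => (hcont k).intervalIntegrable _ _]
  have e : ((n : ℂ)⁻¹ * ∑ k ∈ Finset.range n, ∫ v in (-R)..R, f k v).re
      = (n : ℝ)⁻¹ * ∑ k ∈ Finset.range n, (2 * x) ^ (-γ) * |X k| ^ (2 * γ - 2)
        * (2 * (truncFourier (γ - 1 / 2) R (Real.log (X k ^ 2 / (2 * x)))).re) := by
    rw [show (n : ℂ)⁻¹ = (((n : ℝ)⁻¹ : ℝ) : ℂ) by push_cast; rfl, Complex.re_ofReal_mul,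
      Complex.re_sum]
    congr 1
    refine Finset.sum_congr rfl fun k _ => ?_
    rw [hf]
    simp only []
    rw [intervalIntegral.integral_const_mul, Complex.re_ofReal_mul, re_integral_symm_eq]
  rw [e, mul_left_comm, Finset.mul_sum]
  congr 1
  refine Finset.sum_congr rfl fun k _ => ?_
  rw [estimatorKernel]
  ring

theorem measurable_estimatorKernel (γ x R : ℝ) : Measurable (estimatorKernel γ x R) := by
  have := measurable_truncFourier_log (γ - 1 / 2) (2 * x) R
  unfold estimatorKernel
  fun_prop

/-- A crude bound for fixed `R`: the asymptotic bounds start at some threshold, whereas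
integrability is needed for every `n`. -/
theorem exists_norm_truncFourier_le_of_nonneg (c : ℝ) {R : ℝ} (hR : 0 ≤ R) :
    ∃ C, 0 ≤ C ∧ ∀ w, ‖truncFourier c R w‖ ≤ C := by
  refine ⟨∫ v in (0 : ℝ)..R, ‖(Complex.Gamma (c + Complex.I * v))⁻¹‖,
    intervalIntegral.integral_nonneg hR fun v _ => norm_nonneg _, fun w => ?_⟩
  refine (intervalIntegral.norm_integral_le_integral_norm hR).trans_eq ?_
  refine intervalIntegral.integral_congr fun v _ => ?_
  have e : Complex.I * v * w = ((v * w : ℝ) : ℂ) * Complex.I := by push_cast; ring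
  simp only [norm_mul, e, Complex.norm_exp_ofReal_mul_I, one_mul]

theorem exists_abs_normalizedKernel_le_of_nonneg (c κ s : ℝ) {R : ℝ} (hR : 0 ≤ R) :
    ∃ C, ∀ y, |normalizedKernel c κ s R y| ≤ C * kernelBound κ s y := by
  obtain ⟨C, hC, h⟩ := exists_norm_truncFourier_le_of_nonneg c hR
  refine ⟨|Real.log R / recipGammaGrowth c R| * C, fun y => ?_⟩
  rw [normalizedKernel, abs_mul, abs_of_nonneg (by positivity : 0 ≤ |y| ^ s), Complex.re_ofReal_mul,
    abs_mul, mul_comm]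
  gcongr
  · exact (Complex.abs_re_le_norm _).trans (h _)
  · exact rpow_le_kernelBound κ s y

theorem integrable_estimatorKernel {μ : Measure ℝ} [IsProbabilityMeasure μ] {γ x R : ℝ}
    (hR : 0 ≤ R) (hD : Integrable (fun y => kernelBound (2 * x) (2 * γ - 2) y ^ 2) μ) :
    Integrable (estimatorKernel γ x R) μ := by
  obtain ⟨C, hC, h⟩ := exists_norm_truncFourier_le_of_nonneg (γ - 1 / 2) hR
  have hm := measurable_truncFourier_log (γ - 1 / 2) (2 * x) R
  unfold estimatorKernel
  refine (integrable_of_abs_le_kernelBound hD (by fun_prop) (C := C) fun y => ?_).const_mul _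
  rw [abs_mul, abs_of_nonneg (by positivity : 0 ≤ |y| ^ (2 * γ - 2)), mul_comm]
  gcongr
  · exact (Complex.abs_re_le_norm _).trans (h _)
  · exact rpow_le_kernelBound _ _ y

theorem estimatorKernel_eq {γ x R : ℝ} (hR : 1 < R) (y : ℝ) :
    estimatorKernel γ x R y = recipGammaGrowth (γ - 1 / 2) R / Real.log R *
      (2 * (2 * x) ^ (-γ) / √Real.pi * normalizedKernel (γ - 1 / 2) (2 * x) (2 * γ - 2) R y) := by
  have h1 := (Real.log_pos hR).ne'
  have h2 := (recipGammaGrowth_pos (c := γ - 1 / 2) (zero_lt_one.trans hR)).ne'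
  rw [estimatorKernel, normalizedKernel, Complex.re_ofReal_mul]
  generalize recipGammaGrowth (γ - 1 / 2) R = N at h2 ⊢
  field_simp

theorem sqrt_rate_eq {γ h : ℝ} (hh : 0 < h) (h1 : h < 1) :
    √(h ^ (2 * (γ - 1)) * (Real.log (1 / h)) ^ (-2 : ℤ) * Real.exp (Real.pi / h)) =
      recipGammaGrowth (γ - 1 / 2) (1 / h) / Real.log (1 / h) := by
  have hl : 0 < Real.log (1 / h) := Real.log_pos (by rw [lt_div_iff₀ hh]; linarith)
  have hN := recipGammaGrowth_pos (c := γ - 1 / 2) (one_div_pos.2 hh)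
  rw [← Real.sqrt_sq (div_pos hN hl).le]
  congr 1
  rw [recipGammaGrowth, div_pow, mul_pow, ← Real.exp_nat_mul, ← Real.rpow_natCast ((1 / h) ^ _) 2,
    ← Real.rpow_mul (by positivity), one_div, Real.inv_rpow hh.le, ← Real.rpow_neg hh.le, zpow_neg]
  have e1 : -((1 / 2 - (γ - 1 / 2)) * ((2 : ℕ) : ℝ)) = 2 * (γ - 1) := by push_cast; ring
  have e2 : ((2 : ℕ) : ℝ) * (Real.pi / 2 * h⁻¹) = Real.pi / h := by push_cast; ring
  rw [e1, e2]
  have e3 : Real.log h⁻¹ ^ (2 : ℤ) = Real.log h⁻¹ ^ 2 := by norm_cast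
  rw [e3]
  ring

section

/-! ### Asymptotic normality of the estimator -/

theorem integral_rpow_pos {μ : Measure ℝ} [IsProbabilityMeasure μ] (hne : ∀ᵐ y ∂μ, y ≠ 0) {a : ℝ}
    (ha : Integrable (fun y : ℝ => |y| ^ a) μ) : 0 < ∫ y : ℝ, |y| ^ a ∂μ := by
  have hnn : ∀ y : ℝ, 0 ≤ |y| ^ a := fun y => by positivity
  refine lt_of_le_of_ne (integral_nonneg hnn) fun h => ?_
  have h0 := (integral_eq_zero_iff_of_nonneg hnn ha).1 h.symm
  obtain ⟨y, hy, hy0⟩ := (hne.and h0).exists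
  exact (Real.rpow_pos_of_pos (abs_pos.2 hy) a).ne' hy0

theorem integral_sub_integral_sq {μ : Measure ℝ} [IsProbabilityMeasure μ] {f : ℝ → ℝ} {m r : ℝ}
    (hm : m = ∫ y, f y ∂μ) (h1 : Integrable f μ) (h2 : Integrable (fun y => f y ^ 2) μ) :
    ∫ y, (r * (f y - m)) ^ 2 ∂μ = r ^ 2 * (∫ y, f y ^ 2 ∂μ - m ^ 2) := by
  have e : ∀ y, (r * (f y - m)) ^ 2 = r ^ 2 * (f y ^ 2 - 2 * m * f y + m ^ 2) := fun y => by ring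
  simp only [e]
  have h3 : Integrable (fun y => 2 * m * f y) μ := h1.const_mul _
  have h4 : Integrable (fun y => f y ^ 2 - 2 * m * f y) μ := h2.sub h3
  rw [integral_const_mul, integral_add h4 (integrable_const _), integral_sub h2 h3,
    integral_const_mul, ← hm]
  simp only [integral_const, probReal_univ, one_smul]
  ring

variable {Ω : Type*} {mΩ : MeasurableSpace Ω} {P : Measure Ω}

theorem estimator_ae_eq {X : ℕ → Ω → ℝ} (hX : ∀ᵐ ω ∂P, ∀ k, X k ω ≠ 0) (n : ℕ) {h γ x : ℝ}
    (hh : 0 < h) (hx : 0 < x) :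
    (fun ω => estimator (fun k => X k ω) n h γ x) =ᵐ[P]
      fun ω => (n : ℝ)⁻¹ * ∑ k ∈ Finset.range n, estimatorKernel γ x (1 / h) (X k ω) := by
  filter_upwards [hX] with ω hω using estimator_eq_sum hω n hh hx

/-- The statistical part, separated from Brownian motion: of the law `μ` it needs no atom at zero, a
square-integrable bound and decay of two families of vertical moments. The variance is fixed before
`h` and `ρ` because the kernel moments converge as `R → ∞` along the reals. -/
theorem exists_asymptotic_variance [IsProbabilityMeasure P] {μ : Measure ℝ} {X : ℕ → Ω → ℝ}
    (hX : ∀ k, Measurable (X k)) (hindep : iIndepFun X P)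
    (hlaw : ∀ k, P.map (X k) = μ) {γ x : ℝ} (hγ : 1 / 2 < γ) (hx : 0 < x)
    (hne : ∀ᵐ y ∂μ, y ≠ 0)
    (hD : Integrable (fun y => kernelBound (2 * x) (2 * γ - 2) y ^ 2) μ)
    (hRL₁ : Tendsto (fun u : ℝ => ∫ y : ℝ,
      ((|y| : ℝ) : ℂ) ^ ((2 * γ - 2 : ℝ) + u * Complex.I : ℂ) ∂μ) atTop (𝓝 0))
    (hRL₂ : Tendsto (fun u : ℝ => ∫ y : ℝ,
      ((|y| : ℝ) : ℂ) ^ (((2 * γ - 2) * 2 : ℝ) + u * Complex.I : ℂ) ∂μ) atTop (𝓝 0)) :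
    ∃ σsq : ℝ≥0, 0 < σsq ∧ ∀ (h : ℕ → ℝ), (∀ n, 0 < h n) → Tendsto h atTop (𝓝 0) →
      ∀ (ρ : ℕ → ℝ),
        ρ ~[atTop] (fun n : ℕ => (√(n : ℝ))⁻¹ *
          √(h n ^ (2 * (γ - 1)) * (Real.log (1 / h n)) ^ (-2 : ℤ) * Real.exp (Real.pi / h n))) →
        (∀ n, Integrable (fun ω => estimator (fun k => X k ω) n (h n) γ x) P) ∧
        TendstoInDistribution
          (fun (n : ℕ) (ω : Ω) => (ρ n)⁻¹ * (estimator (fun k => X k ω) n (h n) γ x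
              - ∫ ω', estimator (fun k => X k ω') n (h n) γ x ∂P))
          atTop (id : ℝ → ℝ) (fun _ => P) (gaussianReal 0 σsq) := by
  have hprob : IsProbabilityMeasure μ := hlaw 0 ▸ Measure.isProbabilityMeasure_map (hX 0).aemeasurable
  set c := γ - 1 / 2 with hc
  set κ := 2 * x with hκ
  set s := 2 * γ - 2 with hs
  have hc0 : 0 < c := by rw [hc]; linarith
  have hκ0 : 0 < κ := by positivity
  set M : ℝ := 2 * (2 * x) ^ (-γ) / √Real.pi with hM
  have hM0 : 0 < M := by positivity
  set K : ℂ := ((√2 * √Real.pi : ℝ) : ℂ)⁻¹ with hK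
  have hK0 : K ≠ 0 := inv_ne_zero (by exact_mod_cast (by positivity : √2 * √Real.pi ≠ 0))
  set S : ℝ := M ^ 2 * (1 / 2 * ‖K‖ ^ 2 * ∫ y : ℝ, |y| ^ (s * 2) ∂μ) with hS
  have hS0 : 0 < S := by
    have := integral_rpow_pos hne (integrable_rpow_two_mul_of_kernelBound hD)
    have := norm_pos_iff.2 hK0
    positivity
  have hXne : ∀ᵐ ω ∂P, ∀ k, X k ω ≠ 0 := ae_all_iff.2 fun k => by
    rw [← hlaw k] at hne
    exact ae_of_ae_map (hX k).aemeasurable hne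
  have hident : ∀ k, IdentDistrib (X k) (X 0) P P := fun k =>
    ⟨(hX k).aemeasurable, (hX 0).aemeasurable, by rw [hlaw k, hlaw 0]⟩
  refine ⟨S.toNNReal, Real.toNNReal_pos.2 hS0, fun h hpos hlim ρ hρ => ?_⟩
  have hR : Tendsto (fun n => 1 / h n) atTop atTop := by
    simp only [one_div]
    exact tendsto_inv_nhdsGT_zero.comp (tendsto_nhdsWithin_iff.2 ⟨hlim, Eventually.of_forall hpos⟩)
  have hR0 : ∀ n, 0 < 1 / h n := fun n => one_div_pos.2 (hpos n)
  have hkint : ∀ n k, Integrable (fun ω => estimatorKernel γ x (1 / h n) (X k ω)) P := fun n k => by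
    have := integrable_estimatorKernel (x := x) (γ := γ) (hR0 n).le hD
    rw [← hlaw k] at this
    exact this.comp_measurable (hX k)
  have hest := fun n => estimator_ae_eq hXne n (γ := γ) (hpos n) hx
  have hsumint : ∀ n : ℕ, Integrable (fun ω => (n : ℝ)⁻¹ *
      ∑ k ∈ Finset.range n, estimatorKernel γ x (1 / h n) (X k ω)) P := fun n =>
    (integrable_finsetSum _ fun k _ => hkint n k).const_mul _
  have hint : ∀ n, Integrable (fun ω => estimator (fun k => X k ω) n (h n) γ x) P := fun n =>
    (hsumint n).congr (hest n).symm
  refine ⟨hint, ?_⟩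
  set nk : ℕ → ℝ → ℝ := fun n => normalizedKernel c κ s (1 / h n) with hnk
  set m : ℕ → ℝ := fun n => ∫ y, nk n y ∂μ with hm
  set τ : ℕ → ℝ := fun n => (√(n : ℝ))⁻¹ *
    √(h n ^ (2 * (γ - 1)) * (Real.log (1 / h n)) ^ (-2 : ℤ) * Real.exp (Real.pi / h n)) with hτ
  -- Including `τ n / ρ n` absorbs the factor `1 + o(1)` of the rate, so the normalized estimator is
  -- eventually almost surely equal to the sum in the central limit theorem.
  set f : ℕ → ℝ → ℝ := fun n y => τ n / ρ n * M * (nk n y - m n) with hf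
  have hnkm : ∀ n, Measurable (nk n) := fun n => measurable_normalizedKernel _ _ _ _
  have hnk1 : ∀ n, Integrable (nk n) μ := fun n => by
    obtain ⟨C, hC⟩ := exists_abs_normalizedKernel_le_of_nonneg c κ s (hR0 n).le
    exact integrable_of_abs_le_kernelBound hD (hnkm n) hC
  have hnk2 : ∀ n, Integrable (fun y => nk n y ^ 2) μ := fun n => by
    obtain ⟨C, hC⟩ := exists_abs_normalizedKernel_le_of_nonneg c κ s (hR0 n).le
    exact integrable_sq_of_abs_le_kernelBound hD (hnkm n) hC
  have hfm : ∀ n, Measurable (f n) := fun n => ((hnkm n).sub_const _).const_mul _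
  have hh1 : ∀ᶠ n in atTop, h n < 1 := hlim.eventually_lt_const one_pos
  have hτ0 : ∀ᶠ n in atTop, τ n ≠ 0 := by
    filter_upwards [hh1, eventually_gt_atTop 0] with n hn hn0
    have h1 : 0 < √(n : ℝ) := Real.sqrt_pos.2 (by exact_mod_cast hn0)
    have h2 : 0 < Real.log (1 / h n) := Real.log_pos (by rw [lt_div_iff₀ (hpos n)]; linarith)
    have h3 := recipGammaGrowth_pos (c := γ - 1 / 2) (hR0 n)
    simp only [hτ]
    rw [sqrt_rate_eq (hpos n) hn]
    positivity
  have hratio : Tendsto (fun n => τ n / ρ n) atTop (𝓝 1) := by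
    have := ((isEquivalent_iff_tendsto_one hτ0).1 hρ).inv₀ one_ne_zero
    rw [inv_one] at this
    exact this.congr fun n => by simp
  have hm0 : Tendsto m atTop (𝓝 0) :=
    (tendsto_integral_normalizedKernel hc0 hκ0 hne hD hRL₁).comp hR
  have hsq : Tendsto (fun n => ∫ y, nk n y ^ 2 ∂μ) atTop
      (𝓝 (1 / 2 * ‖K‖ ^ 2 * ∫ y : ℝ, |y| ^ (s * 2) ∂μ)) :=
    (tendsto_integral_normalizedKernel_sq hc0 hκ0 hne hD hRL₂).comp hR
  obtain ⟨C, hC, hbound⟩ := exists_abs_kernel_le hc0 κ s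
  -- In `D`, the `2` bounds `|τ n / ρ n|` and the `1` bounds the mean `|m n|`; both bounds hold for
  -- large `n`.
  have hclt := tendstoInDistribution_of_dominated (P := P) hX hindep hident hfm
    (D := fun y => 2 * M * (C * kernelBound κ s y + 1)) (v := S.toNNReal) ?_ ?_ ?_ ?_
  · have hmeas : ∀ n, AEMeasurable (fun ω => (ρ n)⁻¹ * (estimator (fun k => X k ω) n (h n) γ x
        - ∫ ω', estimator (fun k => X k ω') n (h n) γ x ∂P)) P := fun n =>
      ((hint n).aestronglyMeasurable.aemeasurable.sub_const _).const_mul _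
    refine ⟨hmeas, aemeasurable_id, hclt.tendsto.congr' ?_⟩
    filter_upwards [hh1, eventually_gt_atTop 0, hτ0] with n hn hn0 hτn
    refine Subtype.ext (Measure.map_congr ?_)
    have hn0' : (n : ℝ) ≠ 0 := by exact_mod_cast hn0.ne'
    have hsn : √(n : ℝ) ≠ 0 := (Real.sqrt_pos.2 (by exact_mod_cast hn0)).ne'
    have hR1 : 1 < 1 / h n := by rw [lt_div_iff₀ (hpos n)]; linarith
    have hl : Real.log (1 / h n) ≠ 0 := (Real.log_pos hR1).ne'
    have hN : recipGammaGrowth c (1 / h n) ≠ 0 := (recipGammaGrowth_pos (hR0 n)).ne'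
    have hmean : ∫ ω', estimator (fun k => X k ω') n (h n) γ x ∂P
        = recipGammaGrowth c (1 / h n) / Real.log (1 / h n) * (M * m n) := by
      rw [integral_congr_ae (hest n), integral_const_mul,
        integral_finsetSum _ fun k _ => hkint n k]
      have : ∀ k ∈ Finset.range n, ∫ ω, estimatorKernel γ x (1 / h n) (X k ω) ∂P
          = recipGammaGrowth c (1 / h n) / Real.log (1 / h n) * (M * m n) := by
        intro k _
        rw [← integral_map (hX k).aemeasurable
          (measurable_estimatorKernel γ x _).aestronglyMeasurable, hlaw k]
        simp only [estimatorKernel_eq hR1]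
        rw [integral_const_mul, integral_const_mul]
      rw [Finset.sum_congr rfl this, Finset.sum_const, Finset.card_range, nsmul_eq_mul]
      field_simp
    filter_upwards [hest n] with ω hω
    rw [hω, hmean]
    simp only [estimatorKernel_eq hR1, hf, ← Finset.mul_sum, Finset.sum_sub_distrib,
      Finset.sum_const, Finset.card_range, nsmul_eq_mul]
    have hτe : τ n = (√(n : ℝ))⁻¹ * (recipGammaGrowth c (1 / h n) / Real.log (1 / h n)) := by
      simp only [hτ]
      rw [sqrt_rate_eq (hpos n) hn]
    rw [hτe]
    have hnn : (n : ℝ)⁻¹ = (√(n : ℝ))⁻¹ * (√(n : ℝ))⁻¹ := by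
      rw [← mul_inv, Real.mul_self_sqrt (Nat.cast_nonneg n)]
    have e : ∀ Z : ℝ, (n : ℝ)⁻¹ * (recipGammaGrowth c (1 / h n) / Real.log (1 / h n) * (M * Z))
        - recipGammaGrowth c (1 / h n) / Real.log (1 / h n) * (M * m n)
        = recipGammaGrowth c (1 / h n) / Real.log (1 / h n) * M * ((n : ℝ)⁻¹ * (Z - n * m n)) := by
      intro Z
      field_simp
    rw [e, hnn]
    ring
  · have h1 : MemLp (fun y => 2 * M * (C * kernelBound κ s y + 1)) 2 μ := by
      have : MemLp (kernelBound κ s) 2 μ :=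
        (memLp_two_iff_integrable_sq (measurable_kernelBound κ s).aestronglyMeasurable).2 hD
      exact ((this.const_mul C).add (memLp_const 1)).const_mul (2 * M)
    have h2 := h1.integrable_sq
    rw [← hlaw 0] at h2
    exact h2.comp_measurable (hX 0)
  · have hr2 : ∀ᶠ n in atTop, |τ n / ρ n| ≤ 2 := by
      have := hratio.abs
      rw [abs_one] at this
      exact this.eventually (ge_mem_nhds one_lt_two)
    have hm1 : ∀ᶠ n in atTop, |m n| ≤ 1 := by
      have := hm0.abs
      rw [abs_zero] at this
      exact this.eventually (ge_mem_nhds one_pos)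
    filter_upwards [hr2, hm1, hR.eventually hbound] with n h1 h2 h3
    refine Eventually.of_forall fun ω => ?_
    simp only [hf]
    rw [abs_mul, abs_mul, abs_of_pos hM0]
    gcongr
    exact (abs_sub _ _).trans (add_le_add (h3 _).1 h2)
  · intro n
    rw [← integral_map (hX 0).aemeasurable (hfm n).aestronglyMeasurable, hlaw 0]
    simp only [hf]
    rw [integral_const_mul, integral_sub (hnk1 n) (integrable_const _)]
    simp [hm]
  · have e : ∀ n, ∫ ω, f n (X 0 ω) ^ 2 ∂P
        = (τ n / ρ n * M) ^ 2 * (∫ y, nk n y ^ 2 ∂μ - m n ^ 2) := by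
      intro n
      rw [← integral_map (hX 0).aemeasurable ((hfm n).pow_const 2).aestronglyMeasurable, hlaw 0]
      exact integral_sub_integral_sq rfl (hnk1 n) (hnk2 n)
    simp only [e]
    rw [Real.coe_toNNReal _ hS0.le]
    have := ((hratio.mul_const M).pow 2).mul (hsq.sub (hm0.pow 2))
    simpa [hS] using this

end

end StatSkorohod

/-! ### The theorem: moments of the law of `B_T` and conclusion -/

theorem theorem5
    -- a Brownian motion `B` and an independent random time `T ≥ 0` with Lebesgue density `p`
    {Ω₀ : Type*} [MeasurableSpace Ω₀] (P₀ : Measure Ω₀) [IsProbabilityMeasure P₀]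
    (B : ℝ≥0 → Ω₀ → ℝ) (hBmeas : ∀ t, Measurable (B t)) (hB : IsBrownianReal B P₀)
    (T : Ω₀ → ℝ≥0) (hTmeas : Measurable T)
    (hTB : IndepFun T (fun ω t => B t ω) P₀)
    (p : ℝ → ℝ) (hpmeas : Measurable p) (hp : ∀ t, 0 ≤ p t)
    (hTp : P₀.map (fun ω => (T ω : ℝ)) = volume.withDensity (fun t => ENNReal.ofReal (p t)))
    -- an i.i.d. sample `X` from the law of `B_T`
    {Ω : Type*} [MeasurableSpace Ω] (P : Measure Ω) [IsProbabilityMeasure P]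
    (X : ℕ → Ω → ℝ) (hXmeas : ∀ k, Measurable (X k)) (hXindep : iIndepFun X P)
    (hXlaw : ∀ k, IdentDistrib (X k) (fun ω => B (T ω) ω) P P₀)
    -- a strip where the Mellin transform of `p` is defined, and the position of `γ`
    (a b : ℝ) (ha : 0 ≤ a) (ha1 : a < 1) (hb1 : 1 ≤ b)
    (hstrip : ∀ z : ℂ, a < z.re → z.re < b → MellinConvergent (fun t => (p t : ℂ)) z)
    (γ : ℝ) (hγa : max a (3 / 4) < γ) (hγb : γ < b) (hγa' : a < 2 * γ - 1) (hγb' : 2 * γ - 1 < b)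
    -- the two conditions on the Mellin transform
    (hderiv : deriv (fun u : ℝ =>
        Complex.Gamma (((2 * γ - 3 / 2 : ℝ) : ℂ) + Complex.I * u)
          * mellin (fun t => (p t : ℂ)) (((2 * γ - 1 : ℝ) : ℂ) + Complex.I * u)) 0 ≠ 0)
    (hint : Integrable (fun u : ℝ =>
        mellin (fun t => (p t : ℂ)) (((2 * γ - 1 : ℝ) : ℂ) + Complex.I * u)))
    (x : ℝ) (hx : 0 < x) :
    ∃ σsq : ℝ≥0, 0 < σsq ∧
      ∀ (h : ℕ → ℝ), (∀ n, 0 < h n) →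
        h =Θ[atTop] (fun n : ℕ => (Real.log n)⁻¹) →
      ∀ (ρ : ℕ → ℝ),
        ρ ~[atTop] (fun n : ℕ => (√(n : ℝ))⁻¹ *
          √(h n ^ (2 * (γ - 1)) * (Real.log (1 / h n)) ^ (-2 : ℤ) * Real.exp (Real.pi / h n))) →
        (∀ n, Integrable (fun ω => StatSkorohod.estimator (fun k => X k ω) n (h n) γ x) P) ∧
        TendstoInDistribution
          (fun (n : ℕ) (ω : Ω) => (ρ n)⁻¹ *
            (StatSkorohod.estimator (fun k => X k ω) n (h n) γ x
              - ∫ ω', StatSkorohod.estimator (fun k => X k ω') n (h n) γ x ∂P))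
          atTop (id : ℝ → ℝ) (fun _ => P) (gaussianReal 0 σsq) := by
  have hγ34 : 3 / 4 < γ := (le_max_right _ _).trans_lt hγa
  have hTr : Measurable fun ω => (T ω : ℝ) := by fun_prop
  -- As `T ≥ 0`, the event `T ≤ 0` is `T = 0`, which is null because the law has a density.
  have h0 : volume.withDensity (fun t => ENNReal.ofReal (p t)) (Set.Iic 0) = 0 := by
    have h1 : volume.withDensity (fun t => ENNReal.ofReal (p t)) {0} = 0 :=
      withDensity_absolutelyContinuous _ _ (measure_singleton 0)
    rw [← hTp, Measure.map_apply hTr (measurableSet_singleton 0)] at h1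
    rw [← hTp, Measure.map_apply hTr measurableSet_Iic, ← h1]
    congr 1
    ext ω
    exact ⟨fun h => le_antisymm h (T ω).2, fun h => h.le⟩
  have hlaw : ∀ k, P.map (X k) = StatSkorohod.scaledGaussian p := fun k => by
    rw [(hXlaw k).map_eq, StatSkorohod.map_brownian_independent_time hBmeas hB hTmeas hTB
      (hXlaw 0).aemeasurable_snd, hTp, StatSkorohod.scaledGaussian]
  have hmoment : ∀ q : ℝ, -1 < q → a < q / 2 + 1 → q / 2 + 1 < b →
      Integrable (fun y : ℝ => |y| ^ q) (StatSkorohod.scaledGaussian p) := by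
    intro q h1 h2 h3
    have e : ((q : ℂ) / 2 + 1).re = q / 2 + 1 := by
      rw [Complex.add_re, Complex.one_re, Complex.div_ofNat_re, Complex.ofReal_re]
    exact StatSkorohod.integrable_abs_rpow_scaledGaussian hpmeas hp h0 h1
      (hstrip _ (by rw [e]; exact h2) (by rw [e]; exact h3))
  have hne := StatSkorohod.scaledGaussian_ae_ne_zero h0
  -- The dominating function needs moments of order `4γ - 4` and `4γ - 4 ± ε`. The first constraint
  -- keeps the orders above `-1`, for the Gaussian factor; the other two keep `2γ - 1 ± ε/2` in the
  -- strip.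
  obtain ⟨ε, hε, hε1, hε2, hε3⟩ : ∃ ε > 0, ε < 4 * γ - 3 ∧ ε < 2 * (2 * γ - 1 - a) ∧
      ε < 2 * (b - (2 * γ - 1)) := by
    obtain ⟨ε, hε, h⟩ := exists_between (lt_min (lt_min (by linarith : 0 < 4 * γ - 3)
      (by linarith : 0 < 2 * (2 * γ - 1 - a))) (by linarith : 0 < 2 * (b - (2 * γ - 1))))
    rw [lt_min_iff, lt_min_iff] at h
    exact ⟨ε, hε, h.1.1, h.1.2, h.2⟩
  have hD : Integrable (fun y => StatSkorohod.kernelBound (2 * x) (2 * γ - 2) y ^ 2)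
      (StatSkorohod.scaledGaussian p) := by
    simp only [StatSkorohod.kernelBound, mul_pow, StatSkorohod.rpow_sq_eq]
    refine StatSkorohod.integrable_one_add_abs_log_sq_mul_rpow hε (by positivity) hne
      (hmoment _ ?_ ?_ ?_) (hmoment _ ?_ ?_ ?_) (hmoment _ ?_ ?_ ?_) <;> linarith
  obtain ⟨σsq, hσ, H⟩ := StatSkorohod.exists_asymptotic_variance hXmeas hXindep hlaw
    (by linarith : 1 / 2 < γ) hx hne hD
    (StatSkorohod.tendsto_integral_abs_cpow_scaledGaussian hpmeas hp h0)
    (StatSkorohod.tendsto_integral_abs_cpow_scaledGaussian hpmeas hp h0)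
  refine ⟨σsq, hσ, fun h hpos hΘ ρ hρ => H h hpos ?_ ρ hρ⟩
  exact hΘ.isBigO.trans_tendsto (tendsto_inv_atTop_zero.comp
    (Real.tendsto_log_atTop.comp tendsto_natCast_atTop_atTop))
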